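/- Let $p,B,L\ge 1$, $N=BL$, and let $x[1],\dots,x[N]\in\mathbb{R}^p$ be independent zero-mean Gaussian random vectors such that, for each $b\in\{1,\dots,B\}$, the samples $x[n]$ with $(b-1)L<n\le bL$ have the same covariance matrix $C^{(b)}$. Assume that all eigenvalues of every $C^{(b)}$ lie in $[1,\beta]$, where $\beta\ge 1$, and let $K^{(b)}=(C^{(b)})^{-1}$. For $i\in V=\{1,\dots,p\}$ let $x_i=(x_i[1],\dots,x_i[N])$ be the $i$th component of the process. Let $\mathcal G=(V,E)$ be its conditional independence graph: for $i\ne j$, $\{i,j\}\notin E$ if and only if $x_i$ and $x_j$ are conditionally independent given $\{x_r\}_{r\in V\setminus\{i,j\}}$. Let $\mathcal N(i)=\{j : \{i,j\}\in E\}$. Assume: (1) for some $\rho_{\min}>0$, $\rho_{i,j}:=\frac1B\sum_{b=1}^B \big(K^{(b)}_{i,j}\big)^2/\big(K^{(b)}_{i,i}\big)^2\ge\rho_{\min}$ for all $i\ne j$ with $\{i,j\}\in E$; (2) $|\mathcal N(i)|\le s$ for all $i\in V$, where $s$ is a non-negative integer with $s<\min\{p/3,\,L/3\}$. Fix a node $i\in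 V$. For $j\in V$ and a block $b$ let $x_j^{(b)}=(x_j[(b-1)L+1],\dots,x_j[bL])^T\in\mathbb{R}^L$, and for $T\subseteq V$ let $P^{(b)}_{T^\perp}$ be the orthogonal projection of $\mathbb{R}^L$ onto the orthogonal complement of $\operatorname{span}\{x_j^{(b)}: j\in T\}$. Let $\widehat{\mathcal N}(i)$ be a minimizer of $$\frac1N\sum_{b=1}^B\big\|P^{(b)}_{T^\perp}x_i^{(b)}\big\|_2^2+\lambda|T|,\qquad \lambda=\rho_{\min}/6,$$ over all $T\subseteq V\setminus\{i\}$ with $|T|\le s$. Let $\eta>0$. If $$\rho_{\min}\ge 24\,\beta/L\qquad\text{and}\qquad N\ge 864\,\frac{\beta}{\rho_{\min}}\log\frac{6ps^2}{\eta}$$ (the second condition being void if $s=0$), then $$\mathrm P\{\widehat{\mathcal N}(i)\ne\mathcal N(i)\}\le\eta.$$ More precisely, the event that $\mathcal N(i)$ is not the unique minimizer has probability at most $\eta$. -/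

import Mathlib

open MeasureTheory ProbabilityTheory

noncomputable section

namespace BlockGMS

/-- The index of the `l`-th sample of the `b`-th block: samples are numbered consecutively,
block after block, every block having length `L`. -/
def sampleIdx {B L : ℕ} (b : Fin B) (l : Fin L) : Fin (B * L) := finProdFinEquiv (b, l)

/-- The samples `x 0, x 1, …` (there are `B * L` of them) are independent zero-mean Gaussian random
vectors, and all samples of the `b`-th block have covariance matrix `C b`. -/
structure IsBlockGaussian {Ω : Type*} [MeasurableSpace Ω] (P : Measure Ω) {B L p : ℕ}
    (C : Fin B → Matrix (Fin p) (Fin p) ℝ)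
    (x : Fin (B * L) → Ω → EuclideanSpace ℝ (Fin p)) : Prop where
  measurable : ∀ n, Measurable (x n)
  indep : iIndepFun x P
  map_eq : ∀ (b : Fin B) (l : Fin L),
    P.map (x (sampleIdx b l)) = multivariateGaussian 0 (C b)

/-- The `i`-th process component `(x_i[1], …, x_i[N])`. -/
def component {Ω : Type*} {N p : ℕ} (x : Fin N → Ω → EuclideanSpace ℝ (Fin p)) (i : Fin p)
    (ω : Ω) : Fin N → ℝ := fun n => x n ω i

/-- `f` and `g` are conditionally independent given `h`, with respect to `P`: for all measurable
`s`, `t`, almost surely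
`P (f ∈ s, g ∈ t | σ(h)) = P (f ∈ s | σ(h)) * P (g ∈ t | σ(h))`. -/
def CondIndepGiven {Ω α β γ : Type*} [MeasurableSpace Ω] [MeasurableSpace α] [MeasurableSpace β]
    [mγ : MeasurableSpace γ] (P : Measure Ω) (f : Ω → α) (g : Ω → β) (h : Ω → γ) : Prop :=
  ∀ (s : Set α) (t : Set β), MeasurableSet s → MeasurableSet t →
    P⟦f ⁻¹' s ∩ g ⁻¹' t | mγ.comap h⟧ =ᵐ[P]
      fun ω => (P⟦f ⁻¹' s | mγ.comap h⟧) ω * (P⟦g ⁻¹' t | mγ.comap h⟧) ω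

/-- The conditional independence graph of the process `x`: two distinct nodes `i`, `j` are not
joined if and only if the `i`-th and the `j`-th process components are conditionally independent
given all the remaining components. -/
def cig {Ω : Type*} [MeasurableSpace Ω] (P : Measure Ω) {N p : ℕ}
    (x : Fin N → Ω → EuclideanSpace ℝ (Fin p)) : SimpleGraph (Fin p) where
  Adj i j := i ≠ j ∧ ¬ CondIndepGiven P (component x i) (component x j)
    (fun ω (r : ({i, j}ᶜ : Set (Fin p))) => component x r ω)
  symm := ⟨by
    rintro i j ⟨hij, h⟩
    refine ⟨hij.symm, fun h' => h ?_⟩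
    intro s t hs ht
    have := h' t s ht hs
    rw [Set.pair_comm j i] at this
    rw [Set.inter_comm]
    filter_upwards [this] with ω hω
    rw [hω, mul_comm]⟩
  loopless := ⟨fun i h => h.1 rfl⟩

open Classical in
/-- The neighbourhood of node `i` in a graph on `{1, …, p}`, as a finite set. -/
def nbhd {p : ℕ} (G : SimpleGraph (Fin p)) (i : Fin p) : Finset (Fin p) :=
  Finset.univ.filter fun j => G.Adj i j

/-- The average partial correlation
`ρ_{i,j} = (1/B) ∑_b (K^{(b)}_{i,j})² / (K^{(b)}_{i,i})²` with `K^{(b)} = (C^{(b)})⁻¹`. -/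
def avgPartialCorr {B p : ℕ} (C : Fin B → Matrix (Fin p) (Fin p) ℝ) (i j : Fin p) : ℝ :=
  (1 / (B : ℝ)) * ∑ b, ((C b)⁻¹ i j) ^ 2 / ((C b)⁻¹ i i) ^ 2

/-- The part of the `i`-th component of the observed samples `y` that lies in block `b`,
as a vector in Euclidean space of dimension `L`. -/
def blockVec {B L p : ℕ} (y : Fin (B * L) → EuclideanSpace ℝ (Fin p)) (b : Fin B) (i : Fin p) :
    EuclideanSpace ℝ (Fin L) := WithLp.toLp 2 fun l => y (sampleIdx b l) i

/-- The span, in block `b`, of the components with index in `T`. -/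
def blockSpan {B L p : ℕ} (y : Fin (B * L) → EuclideanSpace ℝ (Fin p)) (b : Fin B)
    (T : Finset (Fin p)) : Submodule ℝ (EuclideanSpace ℝ (Fin L)) :=
  Submodule.span ℝ (blockVec y b '' (T : Set (Fin p)))

/-- The penalized blockwise projection residual of node `i` for the candidate set `T`. -/
def objective {B L p : ℕ} (lam : ℝ) (y : Fin (B * L) → EuclideanSpace ℝ (Fin p)) (i : Fin p)
    (T : Finset (Fin p)) : ℝ :=
  (1 / ((B * L : ℕ) : ℝ)) * ∑ b, ‖(blockSpan y b T)ᗮ.starProjection (blockVec y b i)‖ ^ 2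
    + lam * (T.card : ℝ)

/-- The candidate neighbourhoods of node `i`: sets of at most `s` nodes different from `i`. -/
def candidates (p s : ℕ) (i : Fin p) : Set (Finset (Fin p)) := {T | i ∉ T ∧ T.card ≤ s}

/-- The set of all minimizers of the penalized residual over the candidate neighbourhoods, i.e. all
possible outputs of sparse neighbourhood regression for node `i` on the observed samples `y`. -/
def nbhdEstimates {B L p : ℕ} (lam : ℝ) (s : ℕ) (y : Fin (B * L) → EuclideanSpace ℝ (Fin p))
    (i : Fin p) : Set (Finset (Fin p)) :=
  {T | T ∈ candidates p s i ∧
    ∀ T' ∈ candidates p s i, objective lam y i T ≤ objective lam y i T'}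

end BlockGMS

end

/-!
# Neighbourhood recovery by blockwise sparse regression

Write `S` for the true neighbourhood of `i` and fix a competing candidate `T`, with
`k = |T \ S|` wrongly included and `l = |S \ T|` missed nodes. In each block the `i`-th column
splits as (an element of the span of the columns in `T`) + `w` + `ε`: here `ε` is the regression
noise, with coefficients the normalized `i`-th row of the precision matrix and variance `1 / K_ii`,
and `w` is the part of the missed signal that is uncorrelated with the columns in `T`. The columns
in `T`, the signal `w` and the noise `ε` are independent Gaussians (`map_mask_inner_inner`), and the
variance of `w` is at least the sum of the squared coefficients of the missed nodes, because the
eigenvalues of the covariance are at least `1`.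

With `U = T ∩ S`, the squared residual on `T` minus that on `S` is at least
`‖P w‖² + 2 ⟪P w, ε⟫ - ‖R ε‖²`, where `P` projects onto the orthogonal complement of the span of the
columns in `T`, and `R` onto the part of that span orthogonal to the columns in `U`, a space of
dimension at most `k` (`norm_sq_residual_sub`). Given the columns in `T` and `w`, the last two terms
are independent, so the exponential moment can be integrated out explicitly, the noise before the
signal (`lintegral_exp_residual_gap_le`, `lintegral_exp_residualDiff_le`). Multiplying over the
independent blocks and adding the penalty `λ (k - l)`, Chernoff's bound with parameter `1 / (4 β)`
shows that `T` is at least as good as `S` with probability at most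
`exp (-(ρ N / (48 β)) (k + l))` (`measure_objective_le_objective`): the condition `ρ ≥ 24 β / L` makes
the penalty outweigh overfitting, and `|T| < L / 3` keeps enough residual dimensions to see the signal.
The sample size condition turns this into `q ^ (k + l)` with `q = η / (6 p s²)`, and the sum over all
`T ≠ S`, where `k + l` is the size of the symmetric difference, is `(1 + q) ^ p - 1 ≤ η`
(`sum_pow_card_symmDiff_le`).

The decomposition uses that the `i`-th row of each precision matrix is supported on `S` and `i`, which
is read off from the conditional independence of whole process components
(`inv_apply_eq_zero_of_not_adj`): given the other components, the law of one sample of the pair is a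
translate of the law of its regression residuals, hence these residuals are independent
(`indepFun_residuals_of_condIndepGiven`), and their covariance vanishes only if the entry of the
precision matrix does.
-/

noncomputable section

namespace BlockGMS

/-! ### Exponential moments of Gaussian quadratic forms -/

lemma lintegral_exp_add_sq_gaussianReal (α : ℝ) {γ : ℝ} (hγ : γ < 1 / 2) :
    ∫⁻ x, ENNReal.ofReal (Real.exp (α * x + γ * x ^ 2)) ∂gaussianReal 0 1 =
      ENNReal.ofReal (Real.exp (α ^ 2 / (2 * (1 - 2 * γ))) * (√(1 - 2 * γ))⁻¹) := by
  have hd : 0 < 1 - 2 * γ := by linarith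
  set d := 1 - 2 * γ with hd'
  have hv : (Real.toNNReal d⁻¹) ≠ 0 := by
    simpa using hd
  have hvc : ((Real.toNNReal d⁻¹ : NNReal) : ℝ) = d⁻¹ := Real.coe_toNNReal _ (by positivity)
  rw [gaussianReal_of_var_ne_zero _ one_ne_zero,
    lintegral_withDensity_eq_lintegral_mul _ (measurable_gaussianPDF _ _) (by fun_prop)]
  -- completing the square turns the integrand into a multiple of another Gaussian density
  have key : ∀ x, (gaussianPDF 0 1 * fun x => ENNReal.ofReal (Real.exp (α * x + γ * x ^ 2))) x =
      ENNReal.ofReal (Real.exp (α ^ 2 / (2 * d)) * (√d)⁻¹) *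
        gaussianPDF (α / d) (Real.toNNReal d⁻¹) x := by
    intro x
    simp only [Pi.mul_apply, gaussianPDF]
    rw [← ENNReal.ofReal_mul (gaussianPDFReal_nonneg _ _ _), ← ENNReal.ofReal_mul (by positivity)]
    congr 1
    simp only [gaussianPDFReal, hvc, NNReal.coe_one]
    have h1 : √(2 * Real.pi * d⁻¹) = √(2 * Real.pi) * (√d)⁻¹ := by
      rw [Real.sqrt_mul (by positivity), Real.sqrt_inv]
    have h2 : √d ≠ 0 := (Real.sqrt_pos.2 hd).ne'
    rw [h1, mul_one, mul_assoc, ← Real.exp_add]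
    have h3 : -(x - 0) ^ 2 / (2 * 1) + (α * x + γ * x ^ 2) =
        α ^ 2 / (2 * d) + -(x - α / d) ^ 2 / (2 * d⁻¹) := by
      have : γ = (1 - d) / 2 := by rw [hd']; ring
      rw [this]
      field_simp
      ring
    rw [h3, Real.exp_add]
    field_simp
  simp_rw [key]
  rw [lintegral_const_mul _ (measurable_gaussianPDF _ _), lintegral_gaussianPDF_eq_one _ hv,
    mul_one]

/-- Fubini for a product of functions of separate coordinates. -/
lemma lintegral_pi_prod {ι : Type*} [Fintype ι] {α : ι → Type*} [∀ i, MeasurableSpace (α i)]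
    (μ : ∀ i, Measure (α i)) [∀ i, IsProbabilityMeasure (μ i)] {f : ∀ i, α i → ENNReal}
    (hf : ∀ i, Measurable (f i)) :
    ∫⁻ x, ∏ i, f i (x i) ∂Measure.pi μ = ∏ i, ∫⁻ y, f i y ∂μ i := by
  rw [lintegral_prod_eq_prod_lintegral_of_indepFun Finset.univ (fun i (x : ∀ i, α i) => f i (x i))
    (iIndepFun_pi fun i => (hf i).aemeasurable) (fun i => (hf i).comp (measurable_pi_apply i))]
  refine Finset.prod_congr rfl fun i _ => ?_
  rw [← (measurePreserving_eval μ i).lintegral_comp (hf i)]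

section Euclid

variable {E : Type*} [NormedAddCommGroup E] [InnerProductSpace ℝ E] [FiniteDimensional ℝ E]

/-- An orthonormal basis whose first part spans `S`. -/
lemma exists_orthonormalBasis_adapted (S : Submodule ℝ E) :
    ∃ (m : ℕ) (b : OrthonormalBasis (Fin (Module.finrank ℝ S) ⊕ Fin m) ℝ E),
      (∀ i, b (Sum.inl i) ∈ S) ∧
      ∀ g, ‖S.starProjection g‖ ^ 2 = ∑ i, inner ℝ (b (Sum.inl i)) g ^ 2 := by
  obtain ⟨m, hm⟩ := Nat.exists_eq_add_of_le (Submodule.finrank_le S)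
  let c := stdOrthonormalBasis ℝ S
  let v : Fin (Module.finrank ℝ S) ⊕ Fin m → E := Sum.elim (fun i => (c i : E)) 0
  have hv : Orthonormal ℝ ((Set.range (Sum.inl : Fin (Module.finrank ℝ S) → _ ⊕ Fin m)).domRestrict
      v) := by
    have hc : Orthonormal ℝ (fun i => (c i : E)) := c.orthonormal.comp_linearIsometry S.subtypeₗᵢ
    rw [orthonormal_iff_ite] at hc ⊢
    rintro ⟨_, i, rfl⟩ ⟨_, j, rfl⟩
    have := hc i j
    simpa [v, Subtype.ext_iff] using this
  obtain ⟨b, hb⟩ := Orthonormal.exists_orthonormalBasis_extension_of_card_eq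
    (by simp [hm]) hv
  have hb' : ∀ i, b (Sum.inl i) = c i := fun i => hb _ ⟨i, rfl⟩
  refine ⟨m, b, fun i => by rw [hb']; exact (c i).2, fun g => ?_⟩
  have h1 : ‖S.starProjection g‖ = ‖S.orthogonalProjectionOnto g‖ := rfl
  rw [h1, ← c.sum_sq_norm_inner_right]
  refine Finset.sum_congr rfl fun i _ => ?_
  rw [hb', Real.norm_eq_abs, sq_abs, Submodule.inner_orthogonalProjectionOnto_eq_of_mem_left]

variable [MeasurableSpace E] [BorelSpace E]

/-- Joint exponential moment of a linear form and of the squared norm of a projection under the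
standard Gaussian measure. The linear form and the projection are independent because `u` is
orthogonal to `S`. -/
lemma lintegral_exp_inner_add_sq_stdGaussian (S : Submodule ℝ E) {u : E} (hu : u ∈ Sᗮ) {c : ℝ}
    (hc : c < 1 / 2) :
    ∫⁻ g, ENNReal.ofReal (Real.exp (inner ℝ u g + c * ‖S.starProjection g‖ ^ 2)) ∂stdGaussian E =
      ENNReal.ofReal (Real.exp (‖u‖ ^ 2 / 2) * ((√(1 - 2 * c))⁻¹) ^ Module.finrank ℝ S) := by
  obtain ⟨m, b, hbS, hb⟩ := exists_orthonormalBasis_adapted S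
  have hmeas : Measurable fun g : E =>
      ENNReal.ofReal (Real.exp (inner ℝ u g + c * ‖S.starProjection g‖ ^ 2)) := by fun_prop
  rw [stdGaussian_eq_map_pi_orthonormalBasis b, lintegral_map hmeas (by fun_prop)]
  have hu0 : ∀ i, inner ℝ u (b (Sum.inl i)) = 0 := fun i => by
    rw [real_inner_comm]; exact hu _ (hbS i)
  have hin : ∀ (x : Fin (Module.finrank ℝ S) ⊕ Fin m → ℝ) i,
      inner ℝ (b i) (∑ j, x j • b j) = x i := fun x i => by
    rw [b.orthonormal.inner_right_fintype]
  have key : ∀ x : Fin (Module.finrank ℝ S) ⊕ Fin m → ℝ,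
      ENNReal.ofReal (Real.exp (inner ℝ u (∑ i, x i • b i) +
        c * ‖S.starProjection (∑ i, x i • b i)‖ ^ 2)) =
      ∏ i, (fun y => ENNReal.ofReal (Real.exp (inner ℝ u (b i) * y +
        (Sum.elim (fun _ => c) (fun _ => 0) i) * y ^ 2))) (x i) := by
    intro x
    rw [hb]
    simp_rw [hin]
    rw [← ENNReal.ofReal_prod_of_nonneg (fun i _ => (Real.exp_pos _).le), ← Real.exp_sum,
      inner_sum, Finset.sum_add_distrib]
    congr 3
    · refine Finset.sum_congr rfl fun i _ => ?_
      rw [inner_smul_right, mul_comm]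
    · simp [Finset.mul_sum]
  rw [lintegral_congr key,
    lintegral_pi_prod (fun _ => gaussianReal 0 1) (f := fun i y => ENNReal.ofReal (Real.exp
      (inner ℝ u (b i) * y + (Sum.elim (fun _ => c) (fun _ => 0) i) * y ^ 2)))
      (fun i => by fun_prop)]
  have h1 : ∀ i : Fin (Module.finrank ℝ S) ⊕ Fin m,
      (Sum.elim (fun _ => c) (fun _ => 0) i : ℝ) < 1 / 2 := by
    rintro (i | i) <;> simp only [Sum.elim_inl, Sum.elim_inr] <;> linarith
  rw [Finset.prod_congr rfl fun i _ => lintegral_exp_add_sq_gaussianReal _ (h1 i),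
    ← ENNReal.ofReal_prod_of_nonneg (fun i _ => by positivity)]
  congr 1
  rw [Fintype.prod_sum_type]
  simp only [hu0, Sum.elim_inl, Sum.elim_inr]
  have h2 : ‖u‖ ^ 2 = ∑ i, inner ℝ u (b (Sum.inr i)) ^ 2 := by
    rw [← b.sum_sq_norm_inner_left, Fintype.sum_sum_type]
    simp [hu0]
  rw [h2]
  simp [Finset.sum_div, Real.exp_sum, mul_comm]

end Euclid

/-! ### The gap between two nested projection residuals -/

section Gap

variable {E : Type*} [NormedAddCommGroup E] [InnerProductSpace ℝ E] [FiniteDimensional ℝ E]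

lemma starProjection_inf_orthogonal {U T : Submodule ℝ E} (h : U ≤ T) (e : E) :
    (Uᗮ ⊓ T).starProjection e = T.starProjection e - U.starProjection e := by
  refine (Submodule.eq_starProjection_of_mem_of_inner_eq_zero ⟨?_, ?_⟩ fun r hr => ?_)
  · intro x hx
    have h1 := Submodule.starProjection_inner_eq_zero (K := T) e x (h hx)
    have h2 := Submodule.starProjection_inner_eq_zero (K := U) e x hx
    rw [inner_sub_left] at h1 h2
    rw [inner_sub_right, real_inner_comm, real_inner_comm (U.starProjection e)]
    linarith
  · exact T.sub_mem (Submodule.starProjection_apply_mem _ _)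
      (h (Submodule.starProjection_apply_mem _ _))
  · have h1 := Submodule.starProjection_inner_eq_zero (K := T) e r hr.2
    have h2 := hr.1 _ (Submodule.starProjection_apply_mem U e)
    rw [← sub_add, inner_add_left, h1, h2, add_zero]

/-- Adding `w` to a vector `e` changes the residual on the larger space `T` through its own residual
`u`, while passing from `U` to `T` costs the part of `e` in `T` orthogonal to `U`. That part is
orthogonal to `u`, so for Gaussian `e` the last two terms are independent. -/
lemma norm_sq_residual_sub {U T : Submodule ℝ E} (h : U ≤ T) (w e : E) :
    ‖Tᗮ.starProjection (w + e)‖ ^ 2 - ‖Uᗮ.starProjection e‖ ^ 2 =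
      ‖Tᗮ.starProjection w‖ ^ 2 + 2 * inner ℝ (Tᗮ.starProjection w) e
        - ‖(Uᗮ ⊓ T).starProjection e‖ ^ 2 := by
  have h1 : Uᗮ.starProjection e = Tᗮ.starProjection e + (Uᗮ ⊓ T).starProjection e := by
    rw [starProjection_inf_orthogonal h, Submodule.starProjection_orthogonal_val,
      Submodule.starProjection_orthogonal_val]
    abel
  have h2 : inner ℝ (Tᗮ.starProjection e) ((Uᗮ ⊓ T).starProjection e) = 0 := by
    rw [real_inner_comm]
    exact Submodule.starProjection_apply_mem Tᗮ e _
      (Submodule.starProjection_apply_mem (Uᗮ ⊓ T) e).2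
  have h3 : inner ℝ (Tᗮ.starProjection w) (Tᗮ.starProjection e) =
      inner ℝ (Tᗮ.starProjection w) e := by
    have := Submodule.starProjection_inner_eq_zero (K := Tᗮ) e _
      (Submodule.starProjection_apply_mem Tᗮ w)
    rw [inner_sub_left] at this
    rw [real_inner_comm, real_inner_comm e]
    linarith
  rw [h1, map_add, norm_add_sq_real, norm_add_sq_real, h2, h3]
  ring

lemma inv_sqrt_one_add_le_exp {x : ℝ} (h0 : 0 ≤ x) (h1 : x ≤ 1 / 4) :
    (√(1 + x))⁻¹ ≤ Real.exp (-(2 / 5 * x)) := by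
  rw [Real.exp_neg]
  refine inv_anti₀ (Real.exp_pos _) (Real.le_sqrt_of_sq_le ?_)
  rw [← Real.exp_nat_mul]
  have h2 : 1 - 4 / 5 * x ≤ Real.exp (-(4 / 5 * x)) := by
    have := Real.add_one_le_exp (-(4 / 5 * x)); linarith
  rw [Real.exp_neg] at h2
  have h3 : 0 < 1 - 4 / 5 * x := by linarith
  have h4 : Real.exp (4 / 5 * x) ≤ (1 - 4 / 5 * x)⁻¹ := by
    rw [← inv_inv (Real.exp (4 / 5 * x))]; exact inv_anti₀ h3 h2
  have h5 : (1 - 4 / 5 * x)⁻¹ ≤ 1 + x := by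
    rw [inv_le_iff_one_le_mul₀ h3]; nlinarith
  have h6 : ((2 : ℕ) : ℝ) * (2 / 5 * x) = 4 / 5 * x := by push_cast; ring
  rw [h6]
  exact h4.trans h5

lemma inv_sqrt_one_sub_le_exp {y : ℝ} (h1 : y ≤ 1 / 2) :
    (√(1 - y))⁻¹ ≤ Real.exp (1 / 2) := by
  rw [← inv_inv (Real.exp (1 / 2)), ← Real.exp_neg]
  refine inv_anti₀ (Real.exp_pos _) (Real.le_sqrt_of_sq_le ?_)
  rw [← Real.exp_nat_mul]
  have : Real.exp ((2 : ℕ) * -(1 / 2)) ≤ 1 / 2 := by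
    have h := Real.add_one_le_exp (1 : ℝ)
    have h2 : ((2 : ℕ) : ℝ) * -(1 / 2) = -1 := by norm_num
    rw [h2, Real.exp_neg, one_div]
    exact inv_anti₀ (by norm_num) (by linarith)
  linarith

variable [MeasurableSpace E] [BorelSpace E]

/-- Exponential moment bound for the residual gap of two independent centred isotropic Gaussian
vectors, of variances `a ^ 2` (signal) and `σ ^ 2` (noise). Only a lower bound `m` of the signal
variance enters; `k` bounds the dimension gained by passing from `U` to `T`. -/
lemma lintegral_exp_residual_gap_le {U T : Submodule ℝ E} (h : U ≤ T) {θ m a σ : ℝ} {k n : ℕ}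
    (hθ : 0 < θ) (hσ : σ ^ 2 * θ ≤ 1 / 4) (hm0 : 0 ≤ m) (hma : m ≤ a ^ 2) (hm : θ * m ≤ 1 / 4)
    (hk : Module.finrank ℝ (Uᗮ ⊓ T : Submodule ℝ E) ≤ k)
    (hn : n ≤ Module.finrank ℝ Tᗮ) :
    ∫⁻ w, ∫⁻ e, ENNReal.ofReal (Real.exp (-θ * (‖Tᗮ.starProjection (a • w + σ • e)‖ ^ 2 -
        ‖Uᗮ.starProjection (σ • e)‖ ^ 2))) ∂stdGaussian E ∂stdGaussian E ≤
      ENNReal.ofReal (Real.exp (k / 2 - 2 / 5 * (θ * m) * n)) := by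
  have hinner : ∀ w : E, ∫⁻ e, ENNReal.ofReal (Real.exp (-θ *
      (‖Tᗮ.starProjection (a • w + σ • e)‖ ^ 2 - ‖Uᗮ.starProjection (σ • e)‖ ^ 2)))
        ∂stdGaussian E ≤ ENNReal.ofReal (Real.exp (k / 2)) *
      ENNReal.ofReal (Real.exp (inner ℝ 0 w +
        -(θ * a ^ 2 / 2) * ‖Tᗮ.starProjection w‖ ^ 2)) := by
    intro w
    set u := Tᗮ.starProjection (a • w) with hu
    have huT : u ∈ Tᗮ := Submodule.starProjection_apply_mem _ _
    have hle : (Uᗮ ⊓ T : Submodule ℝ E) ≤ T := inf_le_right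
    have huR : (-(2 * θ * σ)) • u ∈ (Uᗮ ⊓ T)ᗮ :=
      Submodule.smul_mem _ _ (Submodule.orthogonal_le hle huT)
    have hrw : ∀ e, ENNReal.ofReal (Real.exp (-θ * (‖Tᗮ.starProjection (a • w + σ • e)‖ ^ 2 -
        ‖Uᗮ.starProjection (σ • e)‖ ^ 2))) = ENNReal.ofReal (Real.exp (-θ * ‖u‖ ^ 2)) *
        ENNReal.ofReal (Real.exp (inner ℝ ((-(2 * θ * σ)) • u) e + θ * σ ^ 2 *
          ‖(Uᗮ ⊓ T).starProjection e‖ ^ 2)) := by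
      intro e
      rw [norm_sq_residual_sub h, ← ENNReal.ofReal_mul (Real.exp_pos _).le, ← Real.exp_add,
        map_smul (Uᗮ ⊓ T).starProjection, norm_smul, inner_smul_right, inner_smul_left, mul_pow,
        Real.norm_eq_abs, sq_abs, ← hu]
      congr 2
      simp
      ring
    rw [lintegral_congr hrw, lintegral_const_mul _ (by fun_prop),
      lintegral_exp_inner_add_sq_stdGaussian _ huR (by nlinarith),
      ← ENNReal.ofReal_mul (Real.exp_pos _).le, ← ENNReal.ofReal_mul (Real.exp_pos _).le]
    refine ENNReal.ofReal_le_ofReal ?_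
    have h1 : (√(1 - 2 * (θ * σ ^ 2)))⁻¹ ^ Module.finrank ℝ (Uᗮ ⊓ T : Submodule ℝ E) ≤
        Real.exp (k / 2) := by
      refine (pow_le_pow_left₀ (by positivity)
        (inv_sqrt_one_sub_le_exp (by linarith)) _).trans ?_
      rw [← Real.exp_nat_mul]
      refine Real.exp_le_exp.2 ?_
      have : (Module.finrank ℝ (Uᗮ ⊓ T : Submodule ℝ E) : ℝ) ≤ k := by exact_mod_cast hk
      linarith
    have h2 : Real.exp (-θ * ‖u‖ ^ 2) * Real.exp (‖(-(2 * θ * σ)) • u‖ ^ 2 / 2) ≤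
        Real.exp (inner ℝ 0 w + -(θ * a ^ 2 / 2) * ‖Tᗮ.starProjection w‖ ^ 2) := by
      rw [← Real.exp_add]
      refine Real.exp_le_exp.2 ?_
      have h3 : ‖u‖ ^ 2 = a ^ 2 * ‖Tᗮ.starProjection w‖ ^ 2 := by
        rw [hu, map_smul, norm_smul, mul_pow, Real.norm_eq_abs, sq_abs]
      rw [norm_smul, mul_pow, Real.norm_eq_abs, sq_abs, inner_zero_left]
      have h4 : -(θ * a ^ 2 / 2) * ‖Tᗮ.starProjection w‖ ^ 2 = -(θ / 2) * ‖u‖ ^ 2 := by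
        rw [h3]; ring
      rw [h4]
      nlinarith [mul_nonneg hθ.le (sq_nonneg ‖u‖)]
    rw [← mul_assoc]
    calc _ ≤ Real.exp (inner ℝ 0 w + -(θ * a ^ 2 / 2) * ‖Tᗮ.starProjection w‖ ^ 2) *
          Real.exp (k / 2) := by gcongr
      _ = _ := mul_comm _ _
  refine (lintegral_mono hinner).trans ?_
  have ha : 0 ≤ θ * a ^ 2 := by positivity
  rw [lintegral_const_mul _ (by fun_prop),
    lintegral_exp_inner_add_sq_stdGaussian _ (Submodule.zero_mem _) (by linarith),
    ← ENNReal.ofReal_mul (Real.exp_pos _).le, sub_eq_add_neg (k / 2 : ℝ), Real.exp_add]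
  refine ENNReal.ofReal_le_ofReal (mul_le_mul_of_nonneg_left ?_ (Real.exp_pos _).le)
  rw [norm_zero]
  have h5 : (√(1 - 2 * (-(θ * a ^ 2 / 2))))⁻¹ ≤ Real.exp (-(2 / 5 * (θ * m))) := by
    refine le_trans ?_ (inv_sqrt_one_add_le_exp (by positivity) hm)
    refine inv_anti₀ (Real.sqrt_pos.2 (by positivity)) (Real.sqrt_le_sqrt ?_)
    nlinarith
  have h6 : Real.exp (-(2 / 5 * (θ * m))) ≤ 1 := Real.exp_le_one_iff.2 (by
    have : 0 ≤ θ * m := by positivity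
    linarith)
  calc _ = (√(1 - 2 * (-(θ * a ^ 2 / 2))))⁻¹ ^ Module.finrank ℝ Tᗮ := by simp
    _ ≤ Real.exp (-(2 / 5 * (θ * m))) ^ Module.finrank ℝ Tᗮ := by gcongr
    _ ≤ Real.exp (-(2 / 5 * (θ * m))) ^ n := pow_le_pow_of_le_one (Real.exp_pos _).le h6 hn
    _ = _ := by rw [← Real.exp_nat_mul]; congr 1; ring

end Gap

/-! ### Residuals on spans of data columns -/

/-- The residual norm is an infimum of continuous functions of the spanning family and the vector,
hence upper semicontinuous. -/
lemma measurable_norm_residual {κ E : Type*} [Fintype κ] [NormedAddCommGroup E]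
    [InnerProductSpace ℝ E] [FiniteDimensional ℝ E] [MeasurableSpace E] [BorelSpace E] :
    Measurable fun q : (κ → E) × E =>
      ‖(Submodule.span ℝ (Set.range q.1))ᗮ.starProjection q.2‖ := by
  have h : (fun q : (κ → E) × E => ‖(Submodule.span ℝ (Set.range q.1))ᗮ.starProjection q.2‖) =
      fun q => ⨅ c : κ → ℝ, ‖q.2 - ∑ j, c j • q.1 j‖ := by
    funext q
    rw [Submodule.starProjection_orthogonal_val, Submodule.starProjection_minimal]
    refine le_antisymm (le_ciInf fun c => ?_) (le_ciInf fun w => ?_)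
    · exact ciInf_le ⟨0, by rintro _ ⟨w, rfl⟩; positivity⟩
        (⟨∑ j, c j • q.1 j, Submodule.sum_mem _ fun j _ => Submodule.smul_mem _ _
          (Submodule.subset_span ⟨j, rfl⟩)⟩ : Submodule.span ℝ (Set.range q.1))
    · obtain ⟨c, hc⟩ := (Submodule.mem_span_range_iff_exists_fun ℝ).1 w.2
      rw [← hc]
      exact ciInf_le ⟨0, by rintro _ ⟨w, rfl⟩; positivity⟩ c
  rw [h]
  refine UpperSemicontinuous.measurable (upperSemicontinuous_ciInf
    (fun q => ⟨0, by rintro _ ⟨w, rfl⟩; positivity⟩) fun c => Continuous.upperSemicontinuous ?_)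
  fun_prop

/-- The samples of one block, evaluated at the coefficient vector `a`. -/
def colComb {L p : ℕ} (X : Fin L → EuclideanSpace ℝ (Fin p)) (a : EuclideanSpace ℝ (Fin p)) :
    EuclideanSpace ℝ (Fin L) := WithLp.toLp 2 fun l => inner ℝ a (X l)

/-- The `j`-th column of the samples of one block. -/
def col {L p : ℕ} (X : Fin L → EuclideanSpace ℝ (Fin p)) (j : Fin p) :
    EuclideanSpace ℝ (Fin L) := WithLp.toLp 2 fun l => X l j

/-- The span of the columns with index in `T`. -/
def colSpan {L p : ℕ} (X : Fin L → EuclideanSpace ℝ (Fin p)) (T : Finset (Fin p)) :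
    Submodule ℝ (EuclideanSpace ℝ (Fin L)) := Submodule.span ℝ (col X '' (T : Set (Fin p)))

variable {L p : ℕ}

lemma colSpan_mono (X : Fin L → EuclideanSpace ℝ (Fin p)) {U T : Finset (Fin p)} (h : U ⊆ T) :
    colSpan X U ≤ colSpan X T :=
  Submodule.span_mono (Set.image_mono (by exact_mod_cast h))

lemma finrank_colSpan_le (X : Fin L → EuclideanSpace ℝ (Fin p)) (T : Finset (Fin p)) :
    Module.finrank ℝ (colSpan X T) ≤ T.card := by
  classical
  rw [colSpan, ← Finset.coe_image]
  exact (finrank_span_finset_le_card _).trans Finset.card_image_le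

lemma finrank_colSpan_orthogonal_ge (X : Fin L → EuclideanSpace ℝ (Fin p)) (T : Finset (Fin p)) :
    L - T.card ≤ Module.finrank ℝ (colSpan X T)ᗮ := by
  have h1 := (colSpan X T).finrank_add_finrank_orthogonal
  have h2 := finrank_colSpan_le X T
  rw [finrank_euclideanSpace_fin] at h1
  omega

lemma finrank_inf_colSpan_le (X : Fin L → EuclideanSpace ℝ (Fin p)) {U T : Finset (Fin p)}
    (h : U ⊆ T) :
    Module.finrank ℝ ((colSpan X U)ᗮ ⊓ colSpan X T : Submodule ℝ (EuclideanSpace ℝ (Fin L))) ≤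
      (T \ U).card := by
  have h1 := Submodule.finrank_add_inf_finrank_orthogonal (colSpan_mono X h)
  have h2 : colSpan X T = colSpan X U ⊔ colSpan X (T \ U) := by
    rw [colSpan, colSpan, colSpan, ← Submodule.span_union, ← Set.image_union, ← Finset.coe_union,
      Finset.union_sdiff_of_subset h]
  have h3 := Submodule.finrank_add_le_finrank_add_finrank (colSpan X U) (colSpan X (T \ U))
  rw [← h2] at h3
  have h4 := finrank_colSpan_le X (T \ U)
  omega

lemma measurable_col (j : Fin p) :
    Measurable fun X : Fin L → EuclideanSpace ℝ (Fin p) => col X j := by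
  unfold col; fun_prop

lemma measurable_norm_residual_colSpan (T : Finset (Fin p)) {α : Type*} [MeasurableSpace α]
    {X : α → Fin L → EuclideanSpace ℝ (Fin p)} {v : α → EuclideanSpace ℝ (Fin L)}
    (hX : Measurable X) (hv : Measurable v) :
    Measurable fun q => ‖(colSpan (X q) T)ᗮ.starProjection (v q)‖ := by
  have h : ∀ q, colSpan (X q) T =
      Submodule.span ℝ (Set.range fun j : T => col (X q) j) := fun q => by
    rw [colSpan, Set.image_eq_range]; rfl
  simp_rw [h]
  have := (measurable_norm_residual (κ := T) (E := EuclideanSpace ℝ (Fin L))).comp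
    ((measurable_pi_lambda _ fun j : T => (measurable_col (L := L) (j : Fin p)).comp hX).prodMk hv)
  exact this

/-! ### Independent components of a Gaussian sample -/

/-- The vector `x` with the coordinates outside `T` replaced by zero. -/
def mask (T : Finset (Fin p)) (x : EuclideanSpace ℝ (Fin p)) : EuclideanSpace ℝ (Fin p) :=
  WithLp.toLp 2 fun j => if j ∈ T then x j else 0

lemma inner_mask (T : Finset (Fin p)) (x y : EuclideanSpace ℝ (Fin p)) :
    inner ℝ x (mask T y) = inner ℝ (mask T x) y := by
  simp [mask, PiLp.inner_apply]

/-- `mask` as a continuous linear map. -/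
def maskL (T : Finset (Fin p)) : EuclideanSpace ℝ (Fin p) →L[ℝ] EuclideanSpace ℝ (Fin p) :=
  LinearMap.toContinuousLinearMap
    { toFun := mask T
      map_add' := fun x y => by ext j; simp [mask]; split_ifs <;> simp
      map_smul' := fun c x => by ext j; simp [mask] }

lemma colSpan_mask (X : Fin L → EuclideanSpace ℝ (Fin p)) {U T : Finset (Fin p)} (h : U ⊆ T) :
    colSpan (fun l => mask T (X l)) U = colSpan X U := by
  rw [colSpan, colSpan]
  congr 1
  refine Set.image_congr fun j hj => ?_
  ext l
  simp [col, mask, h (Finset.mem_coe.1 hj)]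

open Matrix in
lemma covariance_inner_multivariateGaussian {C : Matrix (Fin p) (Fin p) ℝ} (hC : C.PosSemidef)
    (u v : EuclideanSpace ℝ (Fin p)) :
    cov[fun x => inner ℝ u x, fun x => inner ℝ v x; multivariateGaussian 0 C] =
      u.ofLp ⬝ᵥ C *ᵥ v.ofLp := by
  rw [← covarianceBilin_apply_eq_cov IsGaussian.memLp_two_id,
    covarianceBilin_multivariateGaussian hC]

open Matrix in
lemma map_inner_multivariateGaussian {C : Matrix (Fin p) (Fin p) ℝ} (hC : C.PosSemidef)
    (u : EuclideanSpace ℝ (Fin p)) :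
    (multivariateGaussian 0 C).map (fun x => inner ℝ u x) =
      gaussianReal 0 (u.ofLp ⬝ᵥ C *ᵥ u.ofLp).toNNReal := by
  have h := IsGaussian.map_eq_gaussianReal (μ := multivariateGaussian 0 C) (innerSL ℝ u)
  have h1 : (multivariateGaussian 0 C)[innerSL ℝ u] = 0 := by
    rw [ContinuousLinearMap.integral_comp_id_comm, integral_id_multivariateGaussian, map_zero]
    exact IsGaussian.integrable_id
  have h2 : Var[innerSL ℝ u; multivariateGaussian 0 C] = u.ofLp ⬝ᵥ C *ᵥ u.ofLp := by
    rw [← covariance_inner_multivariateGaussian hC, covariance_self (by fun_prop)]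
    rfl
  rw [h1, h2] at h
  exact h

/-- Uncorrelated linear images of a Gaussian vector are independent: here the masked vector and two
linear forms. -/
lemma indepFun_mask_inner_inner {C : Matrix (Fin p) (Fin p) ℝ} (hC : C.PosSemidef)
    {a k : EuclideanSpace ℝ (Fin p)} {T : Finset (Fin p)}
    (ha : ∀ j ∈ T, (C.mulVec a.ofLp) j = 0) (hk : ∀ j ∈ T, (C.mulVec k.ofLp) j = 0) :
    IndepFun (mask T) (fun x : EuclideanSpace ℝ (Fin p) => ((inner ℝ a x : ℝ), (inner ℝ k x : ℝ)))
      (multivariateGaussian 0 C) := by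
  set μ := multivariateGaussian (0 : EuclideanSpace ℝ (Fin p)) C with hμ
  have hid : HasGaussianLaw (id : EuclideanSpace ℝ (Fin p) → _) μ := ⟨by
    rw [Measure.map_id]; infer_instance⟩
  refine HasGaussianLaw.indepFun_of_covariance_strongDual ?_ ?_
  · exact hid.map_fun ((maskL T).prod ((innerSL ℝ a).prod (innerSL ℝ k)))
  · intro L₁ L₂
    obtain ⟨y, rfl⟩ := (InnerProductSpace.toDual ℝ (EuclideanSpace ℝ (Fin p))).surjective L₁
    have e1 : (InnerProductSpace.toDual ℝ (EuclideanSpace ℝ (Fin p)) y) ∘ mask T =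
        fun x => inner ℝ (mask T y) x := by
      funext x
      rw [Function.comp_apply, InnerProductSpace.toDual_apply_apply, inner_mask]
    have e2 : (L₂ ∘ fun x : EuclideanSpace ℝ (Fin p) =>
        ((inner ℝ a x : ℝ), (inner ℝ k x : ℝ))) =
        fun x => inner ℝ (L₂ (1, 0) • a + L₂ (0, 1) • k) x := by
      funext x
      have : ((inner ℝ a x : ℝ), (inner ℝ k x : ℝ)) =
        (inner ℝ a x : ℝ) • ((1 : ℝ), (0 : ℝ)) + (inner ℝ k x : ℝ) • ((0 : ℝ), (1 : ℝ)) := by simp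
      rw [Function.comp_apply, this, map_add, map_smul, map_smul, inner_add_left,
        real_inner_smul_left, real_inner_smul_left, smul_eq_mul, smul_eq_mul]
      ring
    rw [e1, e2, hμ, covariance_inner_multivariateGaussian hC]
    simp only [dotProduct, WithLp.ofLp_add, WithLp.ofLp_smul, Matrix.mulVec_add,
      Matrix.mulVec_smul, mask, Pi.add_apply, Pi.smul_apply]
    refine Finset.sum_eq_zero fun j _ => ?_
    by_cases hj : j ∈ T
    · simp [ha j hj, hk j hj]
    · simp [hj]

lemma map_mask_inner_inner {C : Matrix (Fin p) (Fin p) ℝ} (hC : C.PosSemidef)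
    {a k : EuclideanSpace ℝ (Fin p)} {T : Finset (Fin p)}
    (ha : ∀ j ∈ T, (C.mulVec a.ofLp) j = 0) (hk : ∀ j ∈ T, (C.mulVec k.ofLp) j = 0)
    (hak : a.ofLp ⬝ᵥ C.mulVec k.ofLp = 0) :
    (multivariateGaussian 0 C).map (fun x => (mask T x, ((inner ℝ a x : ℝ), (inner ℝ k x : ℝ)))) =
      ((multivariateGaussian 0 C).map (mask T)).prod
        (((multivariateGaussian 0 C).map fun x => inner ℝ a x).prod
          ((multivariateGaussian 0 C).map fun x => inner ℝ k x)) := by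
  set μ := multivariateGaussian (0 : EuclideanSpace ℝ (Fin p)) C with hμ
  have hid : HasGaussianLaw (id : EuclideanSpace ℝ (Fin p) → _) μ := ⟨by
    rw [Measure.map_id]; infer_instance⟩
  have hmask : Measurable (mask T : EuclideanSpace ℝ (Fin p) → _) := (maskL T).continuous.measurable
  have h1 : IndepFun (fun x : EuclideanSpace ℝ (Fin p) => (inner ℝ a x : ℝ))
      (fun x => (inner ℝ k x : ℝ)) μ := by
    refine HasGaussianLaw.indepFun_of_covariance_eq_zero ?_ ?_
    · exact hid.map_fun ((innerSL ℝ a).prod (innerSL ℝ k))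
    · rw [hμ, covariance_inner_multivariateGaussian hC, hak]
  rw [(indepFun_iff_map_prod_eq_prod_map_map (by fun_prop) (by fun_prop)).1
      (indepFun_mask_inner_inner hC ha hk),
    (indepFun_iff_map_prod_eq_prod_map_map (by fun_prop) (by fun_prop)).1 h1]

/-- A vector of independent centred Gaussian variables of variance `v` is `√v` times a standard
Gaussian vector. -/
lemma map_toLp_pi_gaussianReal (v : NNReal) :
    (Measure.pi fun _ : Fin L => gaussianReal 0 v).map (WithLp.toLp 2) =
      (stdGaussian (EuclideanSpace ℝ (Fin L))).map (fun g => √(v : ℝ) • g) := by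
  have h : gaussianReal 0 v = (gaussianReal 0 1).map (fun x => √(v : ℝ) * x) := by
    rw [gaussianReal_map_const_mul]
    congr 1
    · simp
    · ext; simp
  rw [h, ← Measure.pi_map_pi (fun _ => by fun_prop), ← map_pi_eq_stdGaussian,
    Measure.map_map (by fun_prop) (by fun_prop), Measure.map_map (by fun_prop) (by fun_prop)]
  rfl

/-- The residual gap in one block of independent Gaussian samples: `colComb X a` is the signal missed
by the candidate set `T` and `colComb X k` is the regression noise, both uncorrelated with the
columns in `T`. -/
lemma lintegral_exp_block_gap_le {C : Matrix (Fin p) (Fin p) ℝ} (hC : C.PosSemidef)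
    {a k : EuclideanSpace ℝ (Fin p)} {U T : Finset (Fin p)} (hUT : U ⊆ T)
    (ha : ∀ j ∈ T, (C.mulVec a.ofLp) j = 0) (hk : ∀ j ∈ T, (C.mulVec k.ofLp) j = 0)
    (hak : a.ofLp ⬝ᵥ C.mulVec k.ofLp = 0) {θ m : ℝ} (hθ : 0 < θ)
    (hσ : k.ofLp ⬝ᵥ C.mulVec k.ofLp * θ ≤ 1 / 4) (hm0 : 0 ≤ m)
    (hma : m ≤ a.ofLp ⬝ᵥ C.mulVec a.ofLp) (hm : θ * m ≤ 1 / 4) :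
    ∫⁻ X, ENNReal.ofReal (Real.exp (-θ *
        (‖(colSpan X T)ᗮ.starProjection (colComb X a + colComb X k)‖ ^ 2 -
          ‖(colSpan X U)ᗮ.starProjection (colComb X k)‖ ^ 2)))
        ∂(Measure.pi fun _ : Fin L => multivariateGaussian 0 C) ≤
      ENNReal.ofReal (Real.exp ((T \ U).card / 2 - 2 / 5 * (θ * m) * (L - T.card : ℕ))) := by
  set μ := multivariateGaussian (0 : EuclideanSpace ℝ (Fin p)) C with hμ
  set va := (a.ofLp ⬝ᵥ C.mulVec a.ofLp).toNNReal with hva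
  set vk := (k.ofLp ⬝ᵥ C.mulVec k.ofLp).toNNReal with hvk
  have hk0 : 0 ≤ k.ofLp ⬝ᵥ C.mulVec k.ofLp := by simpa using hC.dotProduct_mulVec_nonneg k.ofLp
  have hmask : Measurable (mask T : EuclideanSpace ℝ (Fin p) → _) := (maskL T).continuous.measurable
  have hprob : IsProbabilityMeasure (μ.map (mask T)) :=
    Measure.isProbabilityMeasure_map hmask.aemeasurable
  let f : EuclideanSpace ℝ (Fin p) → EuclideanSpace ℝ (Fin p) × ℝ × ℝ :=
    fun x => (mask T x, ((inner ℝ a x : ℝ), (inner ℝ k x : ℝ)))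
  have hf : Measurable f := by fun_prop
  have hlaw : μ.map f = (μ.map (mask T)).prod ((gaussianReal 0 va).prod (gaussianReal 0 vk)) := by
    rw [← map_inner_multivariateGaussian hC, ← map_inner_multivariateGaussian hC]
    exact map_mask_inner_inner hC ha hk hak
  let ν := Measure.pi fun _ : Fin L => μ.map (mask T)
  -- the masked samples and the two linear forms, regrouped into one vector each
  have hpi : MeasurePreserving
      (fun X : Fin L → EuclideanSpace ℝ (Fin p) =>
        ((fun l => mask T (X l)), ((fun l => (inner ℝ a (X l) : ℝ)),
          (fun l => (inner ℝ k (X l) : ℝ)))))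
      (Measure.pi fun _ => μ)
      (ν.prod ((Measure.pi fun _ => gaussianReal 0 va).prod
        (Measure.pi fun _ => gaussianReal 0 vk))) := by
    have h1 : MeasurePreserving (fun (X : Fin L → EuclideanSpace ℝ (Fin p)) l => f (X l))
        (Measure.pi fun _ => μ) (Measure.pi fun _ =>
          (μ.map (mask T)).prod ((gaussianReal 0 va).prod (gaussianReal 0 vk))) := by
      have hs : SigmaFinite (μ.map f) := by rw [hlaw]; infer_instance
      refine ⟨by fun_prop, ?_⟩
      rw [Measure.pi_map_pi (fun _ => hf.aemeasurable), hlaw]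
    have h2 := measurePreserving_arrowProdEquivProdArrow (EuclideanSpace ℝ (Fin p)) (ℝ × ℝ) (Fin L)
      (fun _ => μ.map (mask T)) (fun _ => (gaussianReal 0 va).prod (gaussianReal 0 vk))
    have h3 := measurePreserving_arrowProdEquivProdArrow ℝ ℝ (Fin L)
      (fun _ => gaussianReal 0 va) (fun _ => gaussianReal 0 vk)
    exact ((MeasurePreserving.id ν).prod h3).comp (h2.comp h1)
  let G : (Fin L → EuclideanSpace ℝ (Fin p)) × EuclideanSpace ℝ (Fin L) ×
      EuclideanSpace ℝ (Fin L) → ENNReal := fun q => ENNReal.ofReal (Real.exp (-θ *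
        (‖(colSpan q.1 T)ᗮ.starProjection (q.2.1 + q.2.2)‖ ^ 2 -
          ‖(colSpan q.1 U)ᗮ.starProjection (q.2.2)‖ ^ 2)))
  have hG : Measurable G := by
    have h1 := measurable_norm_residual_colSpan T
      (X := fun q : (Fin L → EuclideanSpace ℝ (Fin p)) × EuclideanSpace ℝ (Fin L) ×
        EuclideanSpace ℝ (Fin L) => q.1) (v := fun q => q.2.1 + q.2.2) (by fun_prop) (by fun_prop)
    have h2 := measurable_norm_residual_colSpan U
      (X := fun q : (Fin L → EuclideanSpace ℝ (Fin p)) × EuclideanSpace ℝ (Fin L) ×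
        EuclideanSpace ℝ (Fin L) => q.1) (v := fun q => q.2.2) (by fun_prop) (by fun_prop)
    fun_prop
  have hG' : Measurable fun q : (Fin L → EuclideanSpace ℝ (Fin p)) × (Fin L → ℝ) × (Fin L → ℝ) =>
      G (q.1, WithLp.toLp 2 q.2.1, WithLp.toLp 2 q.2.2) := hG.comp (by fun_prop)
  have hX : ∀ X, ENNReal.ofReal (Real.exp (-θ *
        (‖(colSpan X T)ᗮ.starProjection (colComb X a + colComb X k)‖ ^ 2 -
          ‖(colSpan X U)ᗮ.starProjection (colComb X k)‖ ^ 2))) =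
      G ((fun l => mask T (X l)), WithLp.toLp 2 (fun l => (inner ℝ a (X l) : ℝ)),
        WithLp.toLp 2 (fun l => (inner ℝ k (X l) : ℝ))) := by
    intro X
    simp only [G, colSpan_mask X hUT, colSpan_mask X (Finset.Subset.refl T)]
    rfl
  rw [lintegral_congr hX, hpi.lintegral_comp hG', lintegral_prod _ hG'.aemeasurable]
  have hbound : ∀ Z : Fin L → EuclideanSpace ℝ (Fin p),
      ∫⁻ q, G (Z, WithLp.toLp 2 q.1, WithLp.toLp 2 q.2)
        ∂((Measure.pi fun _ : Fin L => gaussianReal 0 va).prod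
          (Measure.pi fun _ : Fin L => gaussianReal 0 vk)) ≤
      ENNReal.ofReal (Real.exp ((T \ U).card / 2 - 2 / 5 * (θ * m) * (L - T.card : ℕ))) := by
    intro Z
    have hgap := lintegral_exp_residual_gap_le (colSpan_mono Z hUT) (θ := θ) (m := m)
      (a := √(va : ℝ)) (σ := √(vk : ℝ)) hθ
      (by rw [Real.sq_sqrt vk.coe_nonneg, hvk, Real.coe_toNNReal _ hk0]; exact hσ) hm0
      (by rw [Real.sq_sqrt va.coe_nonneg, hva, Real.coe_toNNReal _ (hm0.trans hma)]; exact hma) hm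
      (finrank_inf_colSpan_le Z hUT) (finrank_colSpan_orthogonal_ge Z T)
    refine le_trans (le_of_eq ?_) hgap
    rw [lintegral_prod _ (by exact (hG'.comp (measurable_prodMk_left (x := Z))).aemeasurable)]
    have hin : ∀ w : EuclideanSpace ℝ (Fin L),
        ∫⁻ e, G (Z, w, WithLp.toLp 2 e) ∂(Measure.pi fun _ : Fin L => gaussianReal 0 vk) =
        ∫⁻ e, G (Z, w, √(vk : ℝ) • e) ∂stdGaussian (EuclideanSpace ℝ (Fin L)) := by
      intro w
      have hGw : Measurable fun e => G (Z, w, e) := hG.comp (by fun_prop)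
      rw [← lintegral_map (f := fun e => G (Z, w, e)) hGw (by fun_prop),
        map_toLp_pi_gaussianReal, lintegral_map hGw (by fun_prop)]
    have hmeas : Measurable fun w => ∫⁻ e, G (Z, w, √(vk : ℝ) • e)
        ∂stdGaussian (EuclideanSpace ℝ (Fin L)) := by
      refine Measurable.lintegral_prod_right' (f := fun q : EuclideanSpace ℝ (Fin L) ×
        EuclideanSpace ℝ (Fin L) => G (Z, q.1, √(vk : ℝ) • q.2)) (hG.comp ?_)
      fun_prop
    simp only [hin]
    rw [← lintegral_map (f := fun w => ∫⁻ e, G (Z, w, √(vk : ℝ) • e)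
        ∂stdGaussian (EuclideanSpace ℝ (Fin L))) hmeas (by fun_prop),
        map_toLp_pi_gaussianReal, lintegral_map hmeas (by fun_prop)]
  refine (lintegral_mono hbound).trans ?_
  rw [lintegral_const, measure_univ, mul_one]

/-! ### Conditional independence forces a zero of the precision matrices -/

/-- Conditioning on `h` integrates out a variable independent of `h`. -/
lemma condExp_comp_prodMk_of_indepFun {Ω α β : Type*} [MeasurableSpace Ω] [mα : MeasurableSpace α]
    [MeasurableSpace β] [StandardBorelSpace β] [Nonempty β] {P : Measure Ω} [IsProbabilityMeasure P]
    {h : Ω → α} {e : Ω → β} (hh : Measurable h) (he : Measurable e) (hind : IndepFun h e P)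
    {F : α × β → ℝ} (hF : StronglyMeasurable F) (hint : Integrable (fun ω => F (h ω, e ω)) P) :
    P[fun ω => F (h ω, e ω) | mα.comap h] =ᵐ[P] fun ω => ∫ y, F (h ω, y) ∂(P.map e) := by
  have h1 := condExp_prod_ae_eq_integral_condDistrib hh he.aemeasurable hF hint
  have : IsProbabilityMeasure (P.map e) := Measure.isProbabilityMeasure_map he.aemeasurable
  have h2 : condDistrib e h P =ᵐ[P.map h] Kernel.const α (P.map e) := by
    refine condDistrib_ae_eq_of_measure_eq_compProd h he.aemeasurable ?_
    rw [Measure.compProd_const]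
    exact (indepFun_iff_map_prod_eq_prod_map_map hh.aemeasurable he.aemeasurable).1 hind
  filter_upwards [h1, ae_of_ae_map hh.aemeasurable h2] with ω hω1 hω2
  rw [hω1, hω2, Kernel.const_apply]

lemma indepFun_of_real_Iic_rat {Ω : Type*} [MeasurableSpace Ω] {P : Measure Ω}
    [IsProbabilityMeasure P] {f g : Ω → ℝ} (hf : Measurable f) (hg : Measurable g)
    (h : ∀ q r : ℚ, P.real (f ⁻¹' Set.Iic (q : ℝ) ∩ g ⁻¹' Set.Iic (r : ℝ)) =
      P.real (f ⁻¹' Set.Iic (q : ℝ)) * P.real (g ⁻¹' Set.Iic (r : ℝ))) :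
    IndepFun f g P := by
  have hgen : ∀ k : Ω → ℝ, (inferInstance : MeasurableSpace ℝ).comap k =
      MeasurableSpace.generateFrom
        (Set.preimage k '' ⋃ a : ℚ, {Set.Iic (a : ℝ)}) := by
    intro k
    rw [← MeasurableSpace.comap_generateFrom, ← Real.borel_eq_generateFrom_Iic_rat]
    congr 1
  have hpi : ∀ k : Ω → ℝ, IsPiSystem (Set.preimage k '' ⋃ a : ℚ, {Set.Iic (a : ℝ)}) := by
    intro k
    exact Real.isPiSystem_Iic_rat.comap k
  refine (IndepFun_iff_Indep _ _ _).2 (IndepSets.indep hf.comap_le hg.comap_le (hpi f) (hpi g)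
    (hgen f) (hgen g) ?_)
  rw [IndepSets_iff]
  rintro _ _ ⟨s, hs, rfl⟩ ⟨t, ht, rfl⟩
  obtain ⟨q, hq⟩ := Set.mem_iUnion.1 hs
  obtain ⟨r, hr⟩ := Set.mem_iUnion.1 ht
  rw [Set.mem_singleton_iff] at hq hr
  subst hq hr
  have := h q r
  simp only [measureReal_def] at this
  rw [← ENNReal.toReal_mul] at this
  exact (ENNReal.toReal_eq_toReal_iff' (measure_ne_top _ _)
    (ENNReal.mul_ne_top (measure_ne_top _ _) (measure_ne_top _ _))).1 this

/-- If two variables are conditionally independent given `h`, and each is a function of `h` plus a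
residual, with residuals jointly independent of `h`, then the residuals are independent. For almost
every `ω` the conditional law given `h` is the law of the residuals translated by a constant; at one
such `ω` all rational quadrants factorize. -/
lemma indepFun_residuals_of_condIndepGiven {Ω γ : Type*} [MeasurableSpace Ω]
    [mγ : MeasurableSpace γ] {P : Measure Ω} [IsProbabilityMeasure P] {e₁ e₂ : Ω → ℝ} {h : Ω → γ}
    {φ ψ : γ → ℝ} (he₁ : Measurable e₁) (he₂ : Measurable e₂) (hh : Measurable h)
    (hφ : Measurable φ) (hψ : Measurable ψ) (hind : IndepFun h (fun ω => (e₁ ω, e₂ ω)) P)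
    (hc : CondIndepGiven P (fun ω => e₁ ω + φ (h ω)) (fun ω => e₂ ω + ψ (h ω)) h) :
    IndepFun e₁ e₂ P := by
  have hset : ∀ S : Set (γ × ℝ × ℝ), MeasurableSet S →
      P⟦{ω | (h ω, e₁ ω, e₂ ω) ∈ S} | mγ.comap h⟧ =ᵐ[P]
        fun ω => P.real {ω' | (h ω, e₁ ω', e₂ ω') ∈ S} := by
    intro S hS
    have hF : StronglyMeasurable (S.indicator fun _ => (1 : ℝ)) :=
      stronglyMeasurable_const.indicator hS
    have hm : MeasurableSet {ω | (h ω, e₁ ω, e₂ ω) ∈ S} :=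
      (hh.prodMk (he₁.prodMk he₂)) hS
    have h1 := condExp_comp_prodMk_of_indepFun hh (he₁.prodMk he₂) hind hF
      ((integrable_const (1 : ℝ)).indicator hm)
    refine h1.trans (Filter.Eventually.of_forall fun ω => ?_)
    have hm' : MeasurableSet {y : ℝ × ℝ | (h ω, y) ∈ S} := measurable_prodMk_left hS
    have h2 : (fun y : ℝ × ℝ => S.indicator (fun _ => (1 : ℝ)) (h ω, y)) =
        {y : ℝ × ℝ | (h ω, y) ∈ S}.indicator 1 := rfl
    simp only [h2]
    rw [integral_indicator_one hm', map_measureReal_apply (he₁.prodMk he₂) hm']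
    rfl
  have hall : ∀ᵐ ω ∂P, ∀ q r : ℚ,
      P.real {ω' | e₁ ω' + φ (h ω) ≤ q ∧ e₂ ω' + ψ (h ω) ≤ r} =
      P.real {ω' | e₁ ω' + φ (h ω) ≤ q} * P.real {ω' | e₂ ω' + ψ (h ω) ≤ r} := by
    rw [ae_all_iff]; intro q
    rw [ae_all_iff]; intro r
    have hA : MeasurableSet {z : γ × ℝ × ℝ | z.2.1 + φ z.1 ≤ q} :=
      measurableSet_le (by fun_prop) (by fun_prop)
    have hB : MeasurableSet {z : γ × ℝ × ℝ | z.2.2 + ψ z.1 ≤ r} :=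
      measurableSet_le (by fun_prop) (by fun_prop)
    filter_upwards [hc (Set.Iic (q : ℝ)) (Set.Iic (r : ℝ)) measurableSet_Iic measurableSet_Iic,
      hset _ hA, hset _ hB, hset _ (hA.inter hB)] with ω h0 h1 h2 h3
    exact h3.symm.trans (h0.trans (congrArg₂ (· * ·) h1 h2))
  obtain ⟨ω, hω⟩ := hall.exists
  have h4 : IndepFun (fun ω' => e₁ ω' + φ (h ω)) (fun ω' => e₂ ω' + ψ (h ω)) P :=
    indepFun_of_real_Iic_rat (he₁.add_const _) (he₂.add_const _) fun q r => hω q r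
  have h5 := h4.comp (φ := fun y => y - φ (h ω)) (ψ := fun y => y - ψ (h ω))
    (measurable_id.sub_const _) (measurable_id.sub_const _)
  simpa [Function.comp_def] using h5

lemma indepFun_prodMk_of_indepFun {Ω α β γ : Type*} [MeasurableSpace Ω] [MeasurableSpace α]
    [MeasurableSpace β] [MeasurableSpace γ] {P : Measure Ω} [IsProbabilityMeasure P]
    {X : Ω → α} {Y : Ω → β} {Z : Ω → γ} (hX : Measurable X) (hY : Measurable Y) (hZ : Measurable Z)
    (h1 : IndepFun X Y P) (h2 : IndepFun (fun ω => (X ω, Y ω)) Z P) :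
    IndepFun X (fun ω => (Y ω, Z ω)) P := by
  have := Measure.isProbabilityMeasure_map (μ := P) hX.aemeasurable
  have := Measure.isProbabilityMeasure_map (μ := P) hY.aemeasurable
  have := Measure.isProbabilityMeasure_map (μ := P) hZ.aemeasurable
  have h3 : IndepFun Y Z P := h2.comp measurable_snd measurable_id
  rw [indepFun_iff_map_prod_eq_prod_map_map (by fun_prop) (by fun_prop)] at *
  rw [h3, ← (measurePreserving_prodAssoc (P.map X) (P.map Y) (P.map Z)).map_eq, ← h1, ← h2,
    Measure.map_map (by fun_prop) (by fun_prop)]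
  rfl

/-- Coordinates off `T` can be prescribed freely while making a vector `C`-orthogonal to the
coordinate directions in `T`: these are the coefficients of the residual of a linear form after
regression on the coordinates in `T`. -/
lemma exists_mulVec_eq_zero_on {C : Matrix (Fin p) (Fin p) ℝ} (hC : C.PosDef)
    (T : Finset (Fin p)) (a₀ : Fin p → ℝ) :
    ∃ a : Fin p → ℝ, (∀ j ∉ T, a j = a₀ j) ∧ ∀ j ∈ T, C.mulVec a j = 0 := by
  let Φ : (Fin p → ℝ) →ₗ[ℝ] (Fin p → ℝ) :=
    { toFun := fun x j => if j ∈ T then C.mulVec x j else x j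
      map_add' := fun x y => by ext j; simp only [Matrix.mulVec_add, Pi.add_apply]; split_ifs <;> rfl
      map_smul' := fun c x => by
        ext j; simp only [Matrix.mulVec_smul, Pi.smul_apply, RingHom.id_apply]; split_ifs <;> rfl }
  have hinj : Function.Injective Φ := by
    rw [injective_iff_map_eq_zero]
    intro x hx
    by_contra hne
    have hpos := hC.dotProduct_mulVec_pos hne
    refine hpos.ne' ?_
    rw [dotProduct]
    refine Finset.sum_eq_zero fun j _ => ?_
    have hj : (if j ∈ T then C.mulVec x j else x j) = 0 := congrFun hx j
    by_cases hjT : j ∈ T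
    · rw [if_pos hjT] at hj; rw [hj, mul_zero]
    · rw [if_neg hjT] at hj; simp [hj]
  obtain ⟨a, ha⟩ := LinearMap.injective_iff_surjective.1 hinj (fun j => if j ∈ T then 0 else a₀ j)
  have ha' : ∀ j, (if j ∈ T then C.mulVec a j else a j) = if j ∈ T then 0 else a₀ j :=
    fun j => congrFun ha j
  refine ⟨a, fun j hj => ?_, fun j hj => ?_⟩
  · simpa [hj] using ha' j
  · simpa [hj] using ha' j

/-- If the residuals of the coordinates `i` and `j` after regression on all the others are
uncorrelated, then the precision matrix vanishes at `(i, j)`: here `C b` is supported at `j`, so `b`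
is a multiple of the `j`-th column of `C⁻¹`, and its `i`-th entry is zero. -/
lemma inv_apply_eq_zero_of_residuals {C : Matrix (Fin p) (Fin p) ℝ} (hC : C.PosDef)
    {i j : Fin p} (hij : i ≠ j) {a b : Fin p → ℝ} (hai : a i = 1) (haj : a j = 0)
    (hbi : b i = 0) (hbj : b j = 1) (hb : ∀ r ∈ ({i, j} : Finset (Fin p))ᶜ, C.mulVec b r = 0)
    (hab : a ⬝ᵥ C.mulVec b = 0) : C⁻¹ i j = 0 := by
  have hoff : ∀ r, r ≠ i → r ≠ j → C.mulVec b r = 0 := fun r h1 h2 => hb r (by simp [h1, h2])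
  have h0 : C.mulVec b i = 0 := by
    rw [dotProduct, Finset.sum_eq_single i] at hab
    · simpa [hai] using hab
    · intro r _ hri
      by_cases hrj : r = j
      · simp [hrj, haj]
      · simp [hoff r hri hrj]
    · simp
  have h1 : C.mulVec b = Pi.single j (C.mulVec b j) := by
    ext r
    by_cases hrj : r = j
    · subst hrj; simp
    · rw [Pi.single_eq_of_ne hrj]
      by_cases hri : r = i
      · rw [hri, h0]
      · exact hoff r hri hrj
  have h2 : b = C⁻¹.mulVec (C.mulVec b) := by
    rw [Matrix.mulVec_mulVec, Matrix.nonsing_inv_mul _ ((Matrix.isUnit_iff_isUnit_det _).1 hC.isUnit),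
      Matrix.one_mulVec]
  rw [h1, Matrix.mulVec_single] at h2
  have h3 : b i = C⁻¹ i j * C.mulVec b j := congrFun h2 i
  have h4 : b j = C⁻¹ j j * C.mulVec b j := congrFun h2 j
  rw [hbi] at h3
  rw [hbj] at h4
  rcases mul_eq_zero.1 h3.symm with h | h
  · exact h
  · rw [h] at h4; simp at h4

/-- A non-edge of the conditional independence graph is a zero of every precision matrix. It suffices
to look at one sample of the block, which explains why the block has to be non-empty. -/
lemma inv_apply_eq_zero_of_not_adj {Ω : Type*} [MeasurableSpace Ω] {P : Measure Ω}
    [IsProbabilityMeasure P] {B L : ℕ} (hL : 0 < L) {C : Fin B → Matrix (Fin p) (Fin p) ℝ}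
    {x : Fin (B * L) → Ω → EuclideanSpace ℝ (Fin p)} (hx : IsBlockGaussian P C x)
    (hC : ∀ b, (C b).PosDef) {i j : Fin p} (hij : i ≠ j) (hadj : ¬ (cig P x).Adj i j) (b : Fin B) :
    (C b)⁻¹ i j = 0 := by
  have hcond : CondIndepGiven P (component x i) (component x j)
      (fun ω (r : ({i, j}ᶜ : Set (Fin p))) => component x r ω) := by
    by_contra h
    exact hadj ⟨hij, h⟩
  set n := sampleIdx b ⟨0, hL⟩ with hn
  have hlaw : P.map (x n) = multivariateGaussian 0 (C b) := hx.map_eq b _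
  set T : Finset (Fin p) := ({i, j} : Finset (Fin p))ᶜ with hT
  have hiT : i ∉ T := by simp [hT]
  have hjT : j ∉ T := by simp [hT]
  obtain ⟨a, ha0, ha⟩ := exists_mulVec_eq_zero_on (hC b) T (Pi.single i 1)
  obtain ⟨c, hc0, hc⟩ := exists_mulVec_eq_zero_on (hC b) T (Pi.single j 1)
  have hai : a i = 1 := by rw [ha0 i hiT]; simp
  have haj : a j = 0 := by rw [ha0 j hjT]; simp [hij.symm]
  have hci : c i = 0 := by rw [hc0 i hiT]; simp [hij]
  have hcj : c j = 1 := by rw [hc0 j hjT]; simp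
  refine inv_apply_eq_zero_of_residuals (hC b) hij hai haj hci hcj hc ?_
  let a' : EuclideanSpace ℝ (Fin p) := WithLp.toLp 2 a
  let c' : EuclideanSpace ℝ (Fin p) := WithLp.toLp 2 c
  have hxm := hx.measurable
  have hmaskm : Measurable (mask T : EuclideanSpace ℝ (Fin p) → _) := (maskL T).continuous.measurable
  -- the residuals are independent of the remaining coordinates of the same sample
  have hres : IndepFun (fun ω => ((inner ℝ a' (x n ω) : ℝ), (inner ℝ c' (x n ω) : ℝ)))
      (fun ω => mask T (x n ω)) P := by
    set μ := multivariateGaussian (0 : EuclideanSpace ℝ (Fin p)) (C b)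
    have h0 : IndepFun (fun y : EuclideanSpace ℝ (Fin p) =>
        ((inner ℝ a' y : ℝ), (inner ℝ c' y : ℝ))) (mask T) μ :=
      (indepFun_mask_inner_inner (hC b).posSemidef ha hc).symm
    rw [indepFun_iff_map_prod_eq_prod_map_map (by fun_prop) (by fun_prop)] at h0 ⊢
    rw [← hlaw, Measure.map_map (by fun_prop) (by fun_prop),
      Measure.map_map (by fun_prop) (by fun_prop), Measure.map_map (by fun_prop) (by fun_prop)] at h0
    exact h0
  have hothers : IndepFun (x n) (fun ω (m : ({n}ᶜ : Finset (Fin (B * L)))) => x m ω) P := by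
    have := hx.indep.indepFun_finset {n} {n}ᶜ (disjoint_compl_right) hxm
    have hm : Measurable fun f : ({n} : Finset (Fin (B * L))) → EuclideanSpace ℝ (Fin p) =>
        f ⟨n, Finset.mem_singleton_self n⟩ := by fun_prop
    exact this.comp hm measurable_id
  have hjoint := indepFun_prodMk_of_indepFun (by fun_prop) (by fun_prop) (by fun_prop) hres
    (hothers.comp (φ := fun y => (((inner ℝ a' y : ℝ), (inner ℝ c' y : ℝ)), mask T y)) (ψ := id)
      (by fun_prop) measurable_id)
  let h : Ω → (({i, j}ᶜ : Set (Fin p)) → Fin (B * L) → ℝ) := fun ω r => component x r ω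
  have hhm : Measurable h := by
    refine measurable_pi_lambda _ fun r => measurable_pi_lambda _ fun m => ?_
    have := hxm m
    change Measurable fun ω => x m ω r
    fun_prop
  have hindh : IndepFun h (fun ω => ((inner ℝ a' (x n ω) : ℝ), (inner ℝ c' (x n ω) : ℝ))) P := by
    have h1 := hjoint.symm.comp
      (φ := fun (q : EuclideanSpace ℝ (Fin p) ×
          (({n}ᶜ : Finset (Fin (B * L))) → EuclideanSpace ℝ (Fin p)))
        (r : ({i, j}ᶜ : Set (Fin p))) (m : Fin (B * L)) =>
        if hm : m = n then q.1 (r : Fin p) else q.2 ⟨m, by simpa using hm⟩ (r : Fin p))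
      (ψ := id) (by
        refine measurable_pi_lambda _ fun r => measurable_pi_lambda _ fun m => ?_
        by_cases hm : m = n
        · simp only [hm, dite_true]; fun_prop
        · simp only [hm, dite_false]; fun_prop) measurable_id
    refine (congrArg (fun k => IndepFun k _ P) ?_).mpr h1
    funext ω r m
    have hrT : (r : Fin p) ∈ T := Finset.mem_compl.2 fun h' => r.2 (by simpa using h')
    by_cases hm : m = n
    · simp [h, component, hm, mask, hrT]
    · simp [h, component, hm]
  -- on the coordinates in `T`, the residual of a coordinate is that coordinate minus a function of `h`
  have hdecomp : ∀ (d : Fin p → ℝ) (t : Fin p), (∀ r ∉ T, d r = (Pi.single t 1 : Fin p → ℝ) r) → t ∉ T → ∀ ω,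
      (inner ℝ (WithLp.toLp 2 d : EuclideanSpace ℝ (Fin p)) (x n ω) : ℝ) +
        (fun z : ({i, j}ᶜ : Set (Fin p)) → Fin (B * L) → ℝ =>
          - ∑ r : ({i, j}ᶜ : Set (Fin p)), d r * z r n) (h ω) = x n ω t := by
    intro d t hd ht ω
    have h1 : ∑ r : ({i, j}ᶜ : Set (Fin p)), d r * h ω r n = ∑ r ∈ T, d r * x n ω r := by
      symm
      refine Finset.sum_subtype T (fun r => ?_) _
      simp [hT]
    have h2 : ∑ r ∈ Tᶜ, d r * x n ω r = x n ω t := by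
      rw [Finset.sum_eq_single t]
      · rw [hd t ht]; simp
      · intro r hr hrt
        rw [hd r (Finset.mem_compl.1 hr), Pi.single_eq_of_ne hrt, zero_mul]
      · intro h; exact absurd (Finset.mem_compl.2 ht) h
    have h3 : (inner ℝ (WithLp.toLp 2 d : EuclideanSpace ℝ (Fin p)) (x n ω) : ℝ) =
        ∑ r, d r * x n ω r := by
      simp [PiLp.inner_apply, mul_comm]
    simp only [h1]
    rw [h3, ← Finset.sum_add_sum_compl T, h2]
    ring
  have hindep : IndepFun (fun ω => (inner ℝ a' (x n ω) : ℝ)) (fun ω => (inner ℝ c' (x n ω) : ℝ)) P := by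
    refine indepFun_residuals_of_condIndepGiven (h := h)
      (φ := fun z => - ∑ r : ({i, j}ᶜ : Set (Fin p)), a r * z r n)
      (ψ := fun z => - ∑ r : ({i, j}ᶜ : Set (Fin p)), c r * z r n)
      (by fun_prop) (by fun_prop) hhm (by fun_prop) (by fun_prop) hindh ?_
    have e1 : (fun ω => (inner ℝ a' (x n ω) : ℝ) +
        (fun z : ({i, j}ᶜ : Set (Fin p)) → Fin (B * L) → ℝ =>
          - ∑ r : ({i, j}ᶜ : Set (Fin p)), a r * z r n) (h ω)) = fun ω => component x i ω n :=
      funext (hdecomp a i ha0 hiT)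
    have e2 : (fun ω => (inner ℝ c' (x n ω) : ℝ) +
        (fun z : ({i, j}ᶜ : Set (Fin p)) → Fin (B * L) → ℝ =>
          - ∑ r : ({i, j}ᶜ : Set (Fin p)), c r * z r n) (h ω)) = fun ω => component x j ω n :=
      funext (hdecomp c j hc0 hjT)
    rw [e1, e2]
    intro s t hs ht
    exact hcond _ _ (measurable_pi_apply n hs) (measurable_pi_apply n ht)
  have hmem : ∀ d : EuclideanSpace ℝ (Fin p), MemLp (fun ω => (inner ℝ d (x n ω) : ℝ)) 2 P := by
    intro d
    have h1 : MemLp (fun y : EuclideanSpace ℝ (Fin p) => (inner ℝ d y : ℝ)) 2 (P.map (x n)) := by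
      rw [hlaw]
      exact IsGaussian.memLp_dual _ (innerSL ℝ d) 2 (by simp)
    exact h1.comp_of_map (hxm n).aemeasurable
  have hcov := hindep.covariance_eq_zero (hmem a') (hmem c')
  rw [← covariance_inner_multivariateGaussian (hC b).posSemidef a' c', ← hlaw,
    covariance_map_fun (by fun_prop) (by fun_prop) (hxm n).aemeasurable]
  exact hcov

/-! ### Regression coefficients and spectral bounds -/

lemma dotProduct_mulVec_eq_sum_eigenvalues {C : Matrix (Fin p) (Fin p) ℝ} (hC : C.IsHermitian)
    (x : Fin p → ℝ) :
    x ⬝ᵥ C.mulVec x =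
      ∑ l, hC.eigenvalues l * (inner ℝ (hC.eigenvectorBasis l) (WithLp.toLp 2 x)) ^ 2 := by
  have h1 : x ⬝ᵥ C.mulVec x = inner ℝ (WithLp.toLp 2 x : EuclideanSpace ℝ (Fin p))
      (WithLp.toLp 2 (C.mulVec x)) := by
    simp [PiLp.inner_apply, dotProduct, mul_comm]
  rw [h1, ← hC.eigenvectorBasis.sum_inner_mul_inner]
  refine Finset.sum_congr rfl fun l _ => ?_
  have h2 : inner ℝ (hC.eigenvectorBasis l) (WithLp.toLp 2 (C.mulVec x)) =
      (hC.eigenvectorBasis l).ofLp ⬝ᵥ C.mulVec x := by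
    simp [PiLp.inner_apply, dotProduct, mul_comm]
  have hT : C.transpose = C := (Matrix.conjTranspose_eq_transpose_of_trivial C).symm.trans hC.eq
  rw [h2, Matrix.dotProduct_mulVec, ← Matrix.mulVec_transpose, hT,
    hC.mulVec_eigenvectorBasis, real_inner_comm]
  have h3 : (hC.eigenvalues l • (hC.eigenvectorBasis l).ofLp) ⬝ᵥ x =
      hC.eigenvalues l * inner ℝ (hC.eigenvectorBasis l) (WithLp.toLp 2 x) := by
    simp [PiLp.inner_apply, dotProduct, Finset.mul_sum, mul_comm, mul_left_comm]
  rw [h3]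
  ring

lemma sum_sq_inner_eigenvectorBasis {C : Matrix (Fin p) (Fin p) ℝ} (hC : C.IsHermitian)
    (x : Fin p → ℝ) :
    ∑ l, (inner ℝ (hC.eigenvectorBasis l) (WithLp.toLp 2 x)) ^ 2 = ∑ j, x j ^ 2 := by
  have h := hC.eigenvectorBasis.sum_sq_norm_inner_right (WithLp.toLp 2 x)
  simpa [EuclideanSpace.norm_sq_eq] using h

lemma sum_sq_le_dotProduct_mulVec {C : Matrix (Fin p) (Fin p) ℝ} (hC : C.IsHermitian)
    (h1 : ∀ l, 1 ≤ hC.eigenvalues l) (x : Fin p → ℝ) :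
    ∑ j, x j ^ 2 ≤ x ⬝ᵥ C.mulVec x := by
  rw [dotProduct_mulVec_eq_sum_eigenvalues hC, ← sum_sq_inner_eigenvectorBasis hC]
  exact Finset.sum_le_sum fun l _ => le_mul_of_one_le_left (sq_nonneg _) (h1 l)

lemma dotProduct_mulVec_le {C : Matrix (Fin p) (Fin p) ℝ} (hC : C.IsHermitian) {β : ℝ}
    (h1 : ∀ l, hC.eigenvalues l ≤ β) (x : Fin p → ℝ) :
    x ⬝ᵥ C.mulVec x ≤ β * ∑ j, x j ^ 2 := by
  rw [dotProduct_mulVec_eq_sum_eigenvalues hC, ← sum_sq_inner_eigenvectorBasis hC, Finset.mul_sum]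
  exact Finset.sum_le_sum fun l _ => mul_le_mul_of_nonneg_right (h1 l) (sq_nonneg _)

/-- The coefficients of the residual of the `i`-th coordinate after regression on all the others:
the `i`-th row of the precision matrix, divided by its diagonal entry. -/
def residualCoeff (C : Matrix (Fin p) (Fin p) ℝ) (i : Fin p) : Fin p → ℝ :=
  fun j => C⁻¹ i j / C⁻¹ i i

lemma mulVec_residualCoeff {C : Matrix (Fin p) (Fin p) ℝ} (hC : C.PosDef) (i : Fin p) :
    C.mulVec (residualCoeff C i) = Pi.single i (C⁻¹ i i)⁻¹ := by
  have hT : C⁻¹.transpose = C⁻¹ :=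
    (Matrix.conjTranspose_eq_transpose_of_trivial _).symm.trans hC.inv.isHermitian.eq
  have h : residualCoeff C i = (C⁻¹ i i)⁻¹ • C⁻¹.mulVec (Pi.single i 1) := by
    ext j
    simp only [residualCoeff, Matrix.mulVec_single_one, Pi.smul_apply, Matrix.col_apply,
      smul_eq_mul]
    have : C⁻¹ j i = C⁻¹ i j := congrFun (congrFun hT i) j
    rw [this, div_eq_inv_mul]
  rw [h, Matrix.mulVec_smul, Matrix.mulVec_mulVec,
    Matrix.mul_nonsing_inv _ ((Matrix.isUnit_iff_isUnit_det _).1 hC.isUnit), Matrix.one_mulVec]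
  ext j
  by_cases hj : j = i
  · subst hj; simp
  · simp [hj]

lemma residualCoeff_self {C : Matrix (Fin p) (Fin p) ℝ} (hC : C.PosDef) (i : Fin p) :
    residualCoeff C i i = 1 := div_self hC.inv.diag_pos.ne'

lemma residualCoeff_dotProduct_mulVec {C : Matrix (Fin p) (Fin p) ℝ} (hC : C.PosDef) (i : Fin p) :
    residualCoeff C i ⬝ᵥ C.mulVec (residualCoeff C i) = (C⁻¹ i i)⁻¹ := by
  rw [mulVec_residualCoeff hC, dotProduct_single, residualCoeff_self hC, one_mul]

/-- The residual variance `1 / K_{ii}` is at most the variance `C_{ii}`. -/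
lemma inv_inv_diag_le {C : Matrix (Fin p) (Fin p) ℝ} (hC : C.PosDef) {β : ℝ}
    (h1 : ∀ l, hC.isHermitian.eigenvalues l ≤ β) (i : Fin p) : (C⁻¹ i i)⁻¹ ≤ β := by
  have hCii := dotProduct_mulVec_le hC.isHermitian h1 (Pi.single i 1)
  have hsum : ∑ j, (Pi.single i 1 : Fin p → ℝ) j ^ 2 = 1 := by
    rw [Finset.sum_eq_single i] <;> simp +contextual
  rw [hsum, mul_one] at hCii
  refine le_trans ?_ hCii
  have h0 := hC.posSemidef.dotProduct_mulVec_nonneg (Pi.single i 1 - residualCoeff C i)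
  rw [star_trivial, Matrix.mulVec_sub, dotProduct_sub, sub_dotProduct, sub_dotProduct,
    residualCoeff_dotProduct_mulVec hC, mulVec_residualCoeff hC, dotProduct_single,
    Pi.single_eq_same, one_mul] at h0
  have hT : C.transpose = C :=
    (Matrix.conjTranspose_eq_transpose_of_trivial C).symm.trans hC.isHermitian.eq
  have h2 : residualCoeff C i ⬝ᵥ C.mulVec (Pi.single i 1) = (C⁻¹ i i)⁻¹ := by
    rw [Matrix.dotProduct_mulVec, ← Matrix.mulVec_transpose, hT, mulVec_residualCoeff hC,
      dotProduct_single, Pi.single_eq_same, mul_one]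
  rw [h2] at h0
  linarith

/-! ### The residual difference in one block -/

lemma colComb_eq_sum (X : Fin L → EuclideanSpace ℝ (Fin p)) (a : EuclideanSpace ℝ (Fin p)) :
    colComb X a = ∑ j, a j • col X j := by
  ext l
  simp [colComb, col, PiLp.inner_apply, mul_comm]

lemma colComb_mem_colSpan (X : Fin L → EuclideanSpace ℝ (Fin p)) {a : EuclideanSpace ℝ (Fin p)}
    {T : Finset (Fin p)} (ha : ∀ j ∉ T, a j = 0) : colComb X a ∈ colSpan X T := by
  rw [colComb_eq_sum]
  refine Submodule.sum_mem _ fun j _ => ?_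
  by_cases hj : j ∈ T
  · exact Submodule.smul_mem _ _ (Submodule.subset_span ⟨j, hj, rfl⟩)
  · rw [ha j hj, zero_smul]; exact Submodule.zero_mem _

lemma starProjection_orthogonal_congr {E : Type*} [NormedAddCommGroup E] [InnerProductSpace ℝ E]
    [FiniteDimensional ℝ E] {S : Submodule ℝ E} {v w : E} (h : v - w ∈ S) :
    Sᗮ.starProjection v = Sᗮ.starProjection w := by
  rw [← sub_eq_zero, ← map_sub]
  exact (Submodule.starProjection_apply_eq_zero_iff _).2 (S.le_orthogonal_orthogonal h)

lemma norm_residual_anti {E : Type*} [NormedAddCommGroup E] [InnerProductSpace ℝ E]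
    [FiniteDimensional ℝ E] {S T : Submodule ℝ E} (h : S ≤ T) (v : E) :
    ‖Tᗮ.starProjection v‖ ≤ ‖Sᗮ.starProjection v‖ := by
  have h1 : Tᗮ.starProjection v = Tᗮ.starProjection (Sᗮ.starProjection v) := by
    have := Submodule.starProjection_comp_starProjection_of_le (Submodule.orthogonal_le h)
    exact (congrArg (fun f => f v) this).symm
  rw [h1]
  exact Submodule.norm_starProjection_apply_le _ _

/-- Squared residual of node `i` regressed on `T` minus that of the regression on `S`. -/
def residualDiff (i : Fin p) (S T : Finset (Fin p)) (X : Fin L → EuclideanSpace ℝ (Fin p)) : ℝ :=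
  ‖(colSpan X T)ᗮ.starProjection (col X i)‖ ^ 2 - ‖(colSpan X S)ᗮ.starProjection (col X i)‖ ^ 2

lemma measurable_residualDiff (i : Fin p) (S T : Finset (Fin p)) :
    Measurable fun X : Fin L → EuclideanSpace ℝ (Fin p) => residualDiff i S T X :=
  ((measurable_norm_residual_colSpan T measurable_id (measurable_col i)).pow_const 2).sub
    ((measurable_norm_residual_colSpan S measurable_id (measurable_col i)).pow_const 2)

/-- The exponential moment of the residual difference in one block, for a set `S` that contains the
support of the `i`-th row of the precision matrix. -/
lemma lintegral_exp_residualDiff_le {C : Matrix (Fin p) (Fin p) ℝ} (hC : C.IsHermitian) {β θ : ℝ}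
    (heig : ∀ l, 1 ≤ hC.eigenvalues l ∧ hC.eigenvalues l ≤ β) {i : Fin p} {S T : Finset (Fin p)}
    (hiS : i ∉ S) (hiT : i ∉ T) (hS : ∀ j, j ≠ i → j ∉ S → C⁻¹ i j = 0)
    (hθ : 0 < θ) (hθβ : β * θ ≤ 1 / 4) :
    ∫⁻ X, ENNReal.ofReal (Real.exp (-θ * residualDiff i S T X))
        ∂(Measure.pi fun _ : Fin L => multivariateGaussian 0 C) ≤
      ENNReal.ofReal (Real.exp ((T \ S).card / 2 -
        2 / 5 * (θ * ∑ j ∈ S \ T, residualCoeff C i j ^ 2) * (L - T.card : ℕ))) := by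
  have hpd : C.PosDef := hC.posDef_iff_eigenvalues_pos.2 fun l => by linarith [(heig l).1]
  set k := residualCoeff C i with hk
  obtain ⟨a, ha0, haT⟩ := exists_mulVec_eq_zero_on hpd T (fun j => if j ∈ S then -k j else 0)
  have hki : k i = 1 := residualCoeff_self hpd i
  have hai : a i = 0 := by rw [ha0 i hiT, if_neg hiS]
  have hkoff : ∀ j, j ≠ i → j ∉ S → k j = 0 := fun j h1 h2 => by
    simp [hk, residualCoeff, hS j h1 h2]
  set m := ∑ j ∈ S \ T, k j ^ 2 with hm
  have hm0 : 0 ≤ m := Finset.sum_nonneg fun j _ => sq_nonneg _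
  have hvar : (C⁻¹ i i)⁻¹ ≤ β := inv_inv_diag_le hpd (fun l => (heig l).2) i
  have hmk : m ≤ (C⁻¹ i i)⁻¹ := by
    rw [← residualCoeff_dotProduct_mulVec hpd]
    refine le_trans ?_ (sum_sq_le_dotProduct_mulVec hC (fun l => (heig l).1) _)
    exact Finset.sum_le_sum_of_subset_of_nonneg (Finset.subset_univ _) fun j _ _ => sq_nonneg _
  have hma : m ≤ a ⬝ᵥ C.mulVec a := by
    refine le_trans ?_ (sum_sq_le_dotProduct_mulVec hC (fun l => (heig l).1) _)
    calc m = ∑ j ∈ S \ T, a j ^ 2 := Finset.sum_congr rfl fun j hj => by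
            rw [ha0 j (Finset.mem_sdiff.1 hj).2, if_pos (Finset.mem_sdiff.1 hj).1, neg_sq]
      _ ≤ _ := Finset.sum_le_sum_of_subset_of_nonneg (Finset.subset_univ _)
            fun j _ _ => sq_nonneg _
  have hkT : ∀ j ∈ T, C.mulVec k j = 0 := fun j hj => by
    rw [hk, mulVec_residualCoeff hpd, Pi.single_eq_of_ne]
    rintro rfl; exact hiT hj
  have hak : a ⬝ᵥ C.mulVec k = 0 := by
    rw [hk, mulVec_residualCoeff hpd, dotProduct_single, hai, zero_mul]
  have hmain := lintegral_exp_block_gap_le (L := L) hpd.posSemidef (a := WithLp.toLp 2 a)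
    (k := WithLp.toLp 2 k) (U := T ∩ S) (T := T) Finset.inter_subset_left haT hkT hak hθ
    (by
      change k ⬝ᵥ C.mulVec k * θ ≤ 1 / 4
      rw [hk, residualCoeff_dotProduct_mulVec hpd]
      exact (mul_le_mul_of_nonneg_right hvar hθ.le).trans hθβ) hm0 hma
    (by rw [mul_comm]; exact (mul_le_mul_of_nonneg_right (hmk.trans hvar) hθ.le).trans hθβ)
  rw [Finset.sdiff_inter_self_left] at hmain
  refine le_trans (lintegral_mono fun X => ENNReal.ofReal_le_ofReal (Real.exp_le_exp.2 ?_)) hmain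
  have hcol : col X i = colComb X (WithLp.toLp 2 (Pi.single i 1)) := by
    rw [colComb_eq_sum, Finset.sum_eq_single i] <;> simp +contextual
  have hlin : ∀ u v : Fin p → ℝ, colComb X (WithLp.toLp 2 u) - colComb X (WithLp.toLp 2 v) =
      colComb X (WithLp.toLp 2 (u - v)) := fun u v => by
    simp only [colComb_eq_sum, ← Finset.sum_sub_distrib, ← sub_smul, Pi.sub_apply]
  have h1 : (colSpan X T)ᗮ.starProjection (col X i) = (colSpan X T)ᗮ.starProjection
      (colComb X (WithLp.toLp 2 a) + colComb X (WithLp.toLp 2 k)) := by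
    refine starProjection_orthogonal_congr ?_
    rw [hcol, ← sub_sub, hlin, hlin]
    refine colComb_mem_colSpan X fun j hj => ?_
    change (Pi.single i 1 : Fin p → ℝ) j - a j - k j = 0
    by_cases hji : j = i
    · subst hji; simp [hai, hki]
    · rw [ha0 j hj, Pi.single_eq_of_ne hji]
      by_cases hjS : j ∈ S
      · simp [hjS]
      · simp [hjS, hkoff j hji hjS]
  have h2 : (colSpan X S)ᗮ.starProjection (col X i) =
      (colSpan X S)ᗮ.starProjection (colComb X (WithLp.toLp 2 k)) := by
    refine starProjection_orthogonal_congr ?_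
    rw [hcol, hlin]
    refine colComb_mem_colSpan X fun j hj => ?_
    change (Pi.single i 1 : Fin p → ℝ) j - k j = 0
    by_cases hji : j = i
    · subst hji; simp [hki]
    · rw [Pi.single_eq_of_ne hji, hkoff j hji hj, sub_zero]
  have h3 := norm_residual_anti (colSpan_mono X (Finset.inter_subset_right : T ∩ S ⊆ S))
    (colComb X (WithLp.toLp 2 k))
  have h4 := pow_le_pow_left₀ (norm_nonneg _) h3 2
  rw [residualDiff, h1, h2]
  nlinarith

/-! ### Independence of the blocks -/

lemma map_uncurry_pi_pi {ι κ E : Type*} [Fintype ι] [Fintype κ] [MeasurableSpace E]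
    (μ : ι → Measure E) [∀ i, IsProbabilityMeasure (μ i)] :
    (Measure.pi fun i => Measure.pi fun _ : κ => μ i).map (fun y (q : ι × κ) => y q.1 q.2) =
      Measure.pi fun q : ι × κ => μ q.1 := by
  symm
  refine Measure.pi_eq fun s hs => ?_
  rw [Measure.map_apply (by fun_prop) (MeasurableSet.univ_pi hs)]
  have h : (fun (y : ι → κ → E) (q : ι × κ) => y q.1 q.2) ⁻¹' Set.univ.pi s =
      Set.univ.pi fun i => Set.univ.pi fun k => s (i, k) := by
    ext y; simp
  rw [h, Measure.pi_pi, Fintype.prod_prod_type]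
  simp_rw [Measure.pi_pi]

lemma lintegral_prod_blocks {Ω : Type*} [MeasurableSpace Ω] {P : Measure Ω}
    [IsProbabilityMeasure P] {B : ℕ} {C : Fin B → Matrix (Fin p) (Fin p) ℝ}
    {x : Fin (B * L) → Ω → EuclideanSpace ℝ (Fin p)} (hx : IsBlockGaussian P C x)
    {g : (Fin L → EuclideanSpace ℝ (Fin p)) → ENNReal} (hg : Measurable g) :
    ∫⁻ ω, ∏ b, g (fun l => x (sampleIdx b l) ω) ∂P =
      ∏ b, ∫⁻ X, g X ∂(Measure.pi fun _ : Fin L => multivariateGaussian 0 (C b)) := by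
  have hxm := hx.measurable
  have hlaw : P.map (fun ω (q : Fin B × Fin L) => x (sampleIdx q.1 q.2) ω) =
      Measure.pi fun q : Fin B × Fin L => multivariateGaussian 0 (C q.1) := by
    refine ((iIndepFun_iff_map_fun_eq_pi_map fun q => (hxm _).aemeasurable).1
      (hx.indep.precomp finProdFinEquiv.injective)).trans ?_
    congr 1
    funext q
    exact hx.map_eq q.1 q.2
  have hG : Measurable fun y : Fin B × Fin L → EuclideanSpace ℝ (Fin p) =>
      ∏ b, g (fun l => y (b, l)) := by fun_prop
  have h1 := lintegral_map (μ := P) hG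
    (g := fun ω (q : Fin B × Fin L) => x (sampleIdx q.1 q.2) ω) (by fun_prop)
  rw [← lintegral_pi_prod _ (fun _ => hg), ← h1, hlaw,
    ← map_uncurry_pi_pi fun b => multivariateGaussian 0 (C b), lintegral_map hG (by fun_prop)]

/-! ### Comparison of one candidate set with the true neighbourhood -/

variable {B : ℕ}

lemma objective_sub_objective (lam : ℝ) (y : Fin (B * L) → EuclideanSpace ℝ (Fin p)) (i : Fin p)
    (S T : Finset (Fin p)) :
    objective lam y i T - objective lam y i S =
      (1 / ((B * L : ℕ) : ℝ)) * ∑ b, residualDiff i S T (fun l => y (sampleIdx b l)) +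
        lam * ((T.card : ℝ) - S.card) := by
  have h : ∀ T : Finset (Fin p), objective lam y i T = (1 / ((B * L : ℕ) : ℝ)) *
      ∑ b, ‖(colSpan (fun l => y (sampleIdx b l)) T)ᗮ.starProjection
        (col (fun l => y (sampleIdx b l)) i)‖ ^ 2 + lam * (T.card : ℝ) := fun _ => rfl
  simp only [h, residualDiff, Finset.sum_sub_distrib]
  ring

/-- The exponents of the blocks and of the penalty, for the Chernoff parameter `1 / (4 * β)`, add up
to a negative multiple of `k + l`, where `k` counts the wrongly included nodes, `l` the missed
ones, and `M` is the sum over all blocks of the squared coefficients of the missed nodes. -/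
lemma chernoff_exponent_le {b L t k l ρ β M : ℝ} (hb : 0 < b) (hL : 0 < L) (hβ : 0 < β)
    (hρ : 0 < ρ) (hk : 0 ≤ k) (hl : 0 ≤ l) (ht : t ≤ L / 3) (hρL : 24 * β ≤ ρ * L)
    (hM : b * l * ρ ≤ M) :
    b * (k / 2) - 2 / 5 * (1 / (4 * β) * M) * (L - t) -
        1 / (4 * β) * ((b * L) * (ρ / 6 * (k - l))) ≤
      -(ρ * (b * L) / (48 * β)) * (k + l) := by
  have h1 : b * l * ρ * (2 * L / 3) ≤ M * (L - t) :=
    mul_le_mul hM (by linarith) (by positivity) (le_trans (by positivity) hM)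
  have h2 : 24 * β * (b * k) ≤ ρ * L * (b * k) :=
    mul_le_mul_of_nonneg_right hρL (by positivity)
  have h3 : 0 ≤ b * l * ρ * L := by positivity
  rw [← sub_nonneg]
  have : -(ρ * (b * L) / (48 * β)) * (k + l) - (b * (k / 2) -
      2 / 5 * (1 / (4 * β) * M) * (L - t) - 1 / (4 * β) * ((b * L) * (ρ / 6 * (k - l)))) =
      (-(ρ * (b * L)) * (k + l) - 24 * β * (b * k) + 24 / 5 * (M * (L - t)) +
        2 * ((b * L) * (ρ * (k - l)))) / (48 * β) := by
    field_simp
    ring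
  rw [this]
  refine div_nonneg ?_ (by positivity)
  nlinarith

/-- A candidate set `T` beats `S` with probability exponentially small in the number of nodes in
which they differ: Chernoff's bound with parameter `1 / (4 * β)`, applied blockwise. The choice keeps
`θ * σ² ≤ 1 / 4` in every block, so that the exponential moments are finite. -/
lemma measure_objective_le_objective {Ω : Type*} [MeasurableSpace Ω] {P : Measure Ω}
    [IsProbabilityMeasure P] {C : Fin B → Matrix (Fin p) (Fin p) ℝ}
    {x : Fin (B * L) → Ω → EuclideanSpace ℝ (Fin p)} (hx : IsBlockGaussian P C x) {ρ β : ℝ}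
    (hB : 0 < B) (hL : 0 < L) (hβ : 1 ≤ β) (hρ : 0 < ρ) (hρL : 24 * β ≤ ρ * L)
    (hC : ∀ b, (C b).IsHermitian)
    (heig : ∀ b l, 1 ≤ (hC b).eigenvalues l ∧ (hC b).eigenvalues l ≤ β) {i : Fin p}
    {S T : Finset (Fin p)} (hiS : i ∉ S) (hiT : i ∉ T)
    (hS : ∀ b j, j ≠ i → j ∉ S → (C b)⁻¹ i j = 0) (hSρ : ∀ j ∈ S, ρ ≤ avgPartialCorr C i j)
    (hT : (T.card : ℝ) ≤ L / 3) :
    P {ω | objective (ρ / 6) (fun n => x n ω) i T ≤ objective (ρ / 6) (fun n => x n ω) i S} ≤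
      ENNReal.ofReal (Real.exp (-(ρ * ((B * L : ℕ) : ℝ) / (48 * β)) * (symmDiff T S).card)) := by
  have hβ0 : 0 < β := by linarith
  have hL' : (0 : ℝ) < L := by exact_mod_cast hL
  have hB' : (0 : ℝ) < B := by exact_mod_cast hB
  set θ : ℝ := 1 / (4 * β) with hθ
  have hθ0 : 0 < θ := by positivity
  have hθβ : β * θ ≤ 1 / 4 := by rw [hθ]; field_simp; norm_num
  set pen : ℝ := -θ * (((B * L : ℕ) : ℝ) * (ρ / 6 * ((T.card : ℝ) - S.card))) with hpen
  let g : (Fin L → EuclideanSpace ℝ (Fin p)) → ENNReal := fun X =>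
    ENNReal.ofReal (Real.exp (-θ * residualDiff i S T X))
  have hg : Measurable g := by
    have := measurable_residualDiff (L := L) i S T
    fun_prop
  have hxm := hx.measurable
  have hf : Measurable fun ω => ENNReal.ofReal (Real.exp pen) *
      ∏ b, g (fun l => x (sampleIdx b l) ω) := by fun_prop
  have hsub : {ω | objective (ρ / 6) (fun n => x n ω) i T ≤
      objective (ρ / 6) (fun n => x n ω) i S} ⊆
      {ω | 1 ≤ ENNReal.ofReal (Real.exp pen) * ∏ b, g (fun l => x (sampleIdx b l) ω)} := by
    intro ω hω
    rw [Set.mem_ofPred_eq, ← sub_nonpos, objective_sub_objective] at hω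
    have hN : (0 : ℝ) < ((B * L : ℕ) : ℝ) := by exact_mod_cast Nat.mul_pos hB hL
    rw [Set.mem_ofPred_eq]
    simp only [g]
    rw [← ENNReal.ofReal_prod_of_nonneg (fun _ _ => (Real.exp_pos _).le), ← Real.exp_sum,
      ← ENNReal.ofReal_mul (Real.exp_pos _).le, ← Real.exp_add, ← ENNReal.ofReal_one]
    refine ENNReal.ofReal_le_ofReal (Real.one_le_exp ?_)
    rw [← Finset.mul_sum, hpen]
    have h1 := mul_nonpos_of_nonneg_of_nonpos hN.le hω
    rw [mul_add, one_div, mul_inv_cancel_left₀ hN.ne'] at h1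
    nlinarith
  refine (measure_mono hsub).trans ?_
  have hmarkov := mul_meas_ge_le_lintegral (μ := P) hf 1
  rw [one_mul] at hmarkov
  refine hmarkov.trans ?_
  rw [lintegral_const_mul _ (by fun_prop), lintegral_prod_blocks hx hg]
  refine (mul_le_mul_right (Finset.prod_le_prod' fun b _ =>
    lintegral_exp_residualDiff_le (hC b) (heig b) hiS hiT (hS b) hθ0 hθβ) _).trans ?_
  rw [← ENNReal.ofReal_prod_of_nonneg (fun _ _ => (Real.exp_pos _).le), ← Real.exp_sum,
    ← ENNReal.ofReal_mul (Real.exp_pos _).le, ← Real.exp_add]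
  refine ENNReal.ofReal_le_ofReal (Real.exp_le_exp.2 ?_)
  have hM : (B : ℝ) * (S \ T).card * ρ ≤ ∑ b, ∑ j ∈ S \ T, residualCoeff (C b) i j ^ 2 := by
    rw [Finset.sum_comm]
    have h1 : ∀ j ∈ S \ T, (B : ℝ) * ρ ≤ ∑ b, residualCoeff (C b) i j ^ 2 := by
      intro j hj
      have h2 := hSρ j (Finset.mem_sdiff.1 hj).1
      rw [avgPartialCorr, one_div, ← div_eq_inv_mul, le_div_iff₀ hB'] at h2
      simp only [residualCoeff, div_pow]
      linarith
    have h3 := Finset.card_nsmul_le_sum _ _ _ h1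
    rw [nsmul_eq_mul] at h3
    linarith
  have hTL : T.card ≤ L := by
    have : (T.card : ℝ) ≤ L := hT.trans (by linarith)
    exact_mod_cast this
  have hcard : (T.card : ℝ) - S.card = (T \ S).card - (S \ T).card := by
    have h1 := Finset.card_sdiff_add_card_inter T S
    have h2 := Finset.card_sdiff_add_card_inter S T
    rw [Finset.inter_comm] at h2
    have h3 : ((T \ S).card : ℝ) + (T ∩ S).card = T.card := by exact_mod_cast h1
    have h4 : ((S \ T).card : ℝ) + (T ∩ S).card = S.card := by exact_mod_cast h2
    linarith
  have hsymm : ((symmDiff T S).card : ℝ) = (T \ S).card + (S \ T).card := by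
    rw [symmDiff_def, Finset.sup_eq_union, Finset.card_union_of_disjoint disjoint_sdiff_sdiff]
    push_cast; rfl
  have hexp := chernoff_exponent_le hB' hL' hβ0 hρ (k := (T \ S).card) (l := (S \ T).card)
    (by positivity) (by positivity) hT hρL hM
  rw [Finset.sum_sub_distrib, ← Finset.sum_mul, ← Finset.mul_sum, ← Finset.mul_sum, hpen, hcard,
    hsymm, Nat.cast_sub hTL, Nat.cast_mul]
  simp only [Finset.sum_const, Finset.card_univ, Fintype.card_fin, nsmul_eq_mul]
  rw [← hθ] at hexp
  linarith

/-! ### Union bound -/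

lemma sum_pow_card_symmDiff_le {q η : ℝ} (hq : 0 ≤ q) (hη : η ≤ 1) (hpq : p * q ≤ η / 2)
    (S : Finset (Fin p)) :
    ∑ T ∈ Finset.univ.erase S, q ^ (symmDiff T S).card ≤ η := by
  have h1 : ∑ T : Finset (Fin p), q ^ (symmDiff T S).card = (1 + q) ^ p := by
    have h2 : ∑ T : Finset (Fin p), q ^ (symmDiff T S).card = ∑ D : Finset (Fin p), q ^ D.card :=
      Equiv.sum_comp (Function.Involutive.toPerm _ (symmDiff_left_involutive S))
        (fun D : Finset (Fin p) => q ^ D.card)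
    have h3 := Finset.sum_pow_mul_eq_add_pow q 1 (Finset.univ : Finset (Fin p))
    simp only [one_pow, mul_one, Finset.powerset_univ, Finset.card_univ, Fintype.card_fin] at h3
    rw [h2, h3, add_comm]
  have h2 : ∑ T ∈ Finset.univ.erase S, q ^ (symmDiff T S).card = (1 + q) ^ p - 1 := by
    rw [← h1, ← Finset.add_sum_erase _ _ (Finset.mem_univ S), symmDiff_self]
    simp
  have h0 : 0 ≤ (p : ℝ) * q := by positivity
  have h3 : (1 + q) ^ p ≤ Real.exp (p * q) := by
    rw [Real.exp_nat_mul]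
    refine pow_le_pow_left₀ (by positivity) ?_ _
    rw [add_comm]; exact Real.add_one_le_exp q
  have h4 := Real.abs_exp_sub_one_le (x := p * q) (by rw [abs_of_nonneg h0]; linarith)
  rw [abs_of_nonneg h0] at h4
  have h5 := le_abs_self (Real.exp (p * q) - 1)
  linarith

end BlockGMS

end

theorem theorem1 {Ω : Type*} [MeasurableSpace Ω] (P : Measure Ω) [IsProbabilityMeasure P]
    (B L p s : ℕ) (hB : 0 < B) (ρmin β η : ℝ)
    (C : Fin B → Matrix (Fin p) (Fin p) ℝ)
    (x : Fin (B * L) → Ω → EuclideanSpace ℝ (Fin p))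
    (hx : BlockGMS.IsBlockGaussian P C x)
    -- minimum average partial correlation over the edges
    (hρpos : 0 < ρmin)
    (hρ : ∀ j k : Fin p, (BlockGMS.cig P x).Adj j k → ρmin ≤ BlockGMS.avgPartialCorr C j k)
    -- maximum degree and sparsity
    (hdeg : ∀ j : Fin p, (BlockGMS.nbhd (BlockGMS.cig P x) j).card ≤ s)
    (hs : (s : ℝ) < min ((p : ℝ) / 3) ((L : ℝ) / 3))
    -- the covariance matrices are symmetric with eigenvalues between `1` and `β`
    (hC : ∀ b : Fin B, (C b).IsHermitian)
    (heig : ∀ (b : Fin B) (l : Fin p), 1 ≤ (hC b).eigenvalues l ∧ (hC b).eigenvalues l ≤ β)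
    (hβ : 1 ≤ β)
    (i : Fin p) (hη : 0 < η)
    (hρL : 24 * β / (L : ℝ) ≤ ρmin)
    (hN : 864 * (β / ρmin) * Real.log (6 * (p : ℝ) * (s : ℝ) ^ 2 / η) ≤ ((B * L : ℕ) : ℝ)) :
    P {ω | BlockGMS.nbhdEstimates (ρmin / 6) s (fun n => x n ω) i ≠
      {BlockGMS.nbhd (BlockGMS.cig P x) i}} ≤ ENNReal.ofReal η := by
  classical
  rcases le_or_gt 1 η with hη1 | hη1
  · exact prob_le_one.trans (by rw [← ENNReal.ofReal_one]; exact ENNReal.ofReal_le_ofReal hη1)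
  set S := BlockGMS.nbhd (BlockGMS.cig P x) i with hSdef
  have hs0 : (0 : ℝ) ≤ s := by positivity
  have hsL : (s : ℝ) < L / 3 := hs.trans_le (min_le_right _ _)
  have hL' : (0 : ℝ) < L := by linarith
  have hL : 0 < L := by exact_mod_cast hL'
  have hp' : (0 : ℝ) < p := by exact_mod_cast Fin.pos i
  have hβ0 : 0 < β := by linarith
  have hρL' : 24 * β ≤ ρmin * L := (div_le_iff₀ hL').1 hρL
  have hmem : ∀ j, j ∈ S ↔ (BlockGMS.cig P x).Adj i j := fun j => by
    simp [hSdef, BlockGMS.nbhd]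
  have hiS : i ∉ S := fun h => (BlockGMS.cig P x).loopless.irrefl i ((hmem i).1 h)
  have hpd : ∀ b, (C b).PosDef := fun b =>
    (hC b).posDef_iff_eigenvalues_pos.2 fun l => by linarith [(heig b l).1]
  have hScand : S ∈ BlockGMS.candidates p s i := ⟨hiS, hdeg i⟩
  set 𝒯 := Finset.univ.filter fun T : Finset (Fin p) => T ∈ BlockGMS.candidates p s i ∧ T ≠ S
    with h𝒯
  -- a competing minimizer, or a strictly better candidate, beats the true neighbourhood
  have hsub : {ω | BlockGMS.nbhdEstimates (ρmin / 6) s (fun n => x n ω) i ≠ {S}} ⊆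
      ⋃ T ∈ 𝒯, {ω | BlockGMS.objective (ρmin / 6) (fun n => x n ω) i T ≤
        BlockGMS.objective (ρmin / 6) (fun n => x n ω) i S} := by
    intro ω hω
    by_contra hcon
    simp only [Set.mem_iUnion, not_exists, Set.mem_ofPred_eq, not_le] at hcon
    have hbest : ∀ T ∈ BlockGMS.candidates p s i, T ≠ S →
        BlockGMS.objective (ρmin / 6) (fun n => x n ω) i S <
          BlockGMS.objective (ρmin / 6) (fun n => x n ω) i T :=
      fun T hT hne => hcon T (by simp [h𝒯, hT, hne])
    refine hω (Set.eq_singleton_iff_unique_mem.2 ⟨⟨hScand, fun T hT => ?_⟩, fun T hT => ?_⟩)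
    · by_cases hne : T = S
      · rw [hne]
      · exact (hbest T hT hne).le
    · by_contra hne
      exact (hbest T hT.1 hne).not_ge (hT.2 S hScand)
  refine (measure_mono hsub).trans ((measure_biUnion_finset_le _ _).trans ?_)
  rcases Nat.eq_zero_or_pos s with hs00 | hspos
  · -- the empty set is the only candidate
    have hempty : 𝒯 = ∅ := by
      refine Finset.eq_empty_of_forall_notMem fun T hT => ?_
      obtain ⟨hT1, hT2⟩ := (Finset.mem_filter.1 hT).2
      have hSc := hScand.2
      have hTc := hT1.2
      rw [hs00, Nat.le_zero, Finset.card_eq_zero] at hSc hTc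
      exact hT2 (hTc.trans hSc.symm)
    rw [hempty]; simp
  have hs1 : (1 : ℝ) ≤ s := by exact_mod_cast hspos
  have hs2 : (1 : ℝ) ≤ (s : ℝ) ^ 2 := one_le_pow₀ hs1
  have hp1 : (1 : ℝ) ≤ p := by exact_mod_cast Fin.pos i
  set Q := 6 * (p : ℝ) * (s : ℝ) ^ 2 / η with hQ
  have hQ0 : 0 < Q := by positivity
  have hQ1 : 1 ≤ Q := by
    rw [hQ, le_div_iff₀ hη]
    nlinarith
  have hlog : 0 ≤ Real.log Q := Real.log_nonneg hQ1
  -- the sample size condition leaves room: `log Q` is at most an eighteenth of the exponent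
  have hrate : Real.log Q ≤ ρmin * ((B * L : ℕ) : ℝ) / (48 * β) := by
    rw [le_div_iff₀ (by positivity)]
    have h1 := mul_le_mul_of_nonneg_left hN hρpos.le
    have h2 : ρmin * (864 * (β / ρmin) * Real.log Q) = 864 * β * Real.log Q := by field_simp
    rw [h2] at h1
    nlinarith [mul_nonneg hβ0.le hlog]
  have hT : ∀ T ∈ 𝒯, P {ω | BlockGMS.objective (ρmin / 6) (fun n => x n ω) i T ≤
      BlockGMS.objective (ρmin / 6) (fun n => x n ω) i S} ≤
      ENNReal.ofReal (Q⁻¹ ^ (symmDiff T S).card) := by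
    intro T hT
    obtain ⟨hT1, hT2⟩ := (Finset.mem_filter.1 hT).2
    have hTs : (T.card : ℝ) ≤ s := by exact_mod_cast hT1.2
    refine (BlockGMS.measure_objective_le_objective hx hB hL hβ hρpos hρL' hC heig hiS hT1.1
      (fun b j hji hjS => BlockGMS.inv_apply_eq_zero_of_not_adj hL hx hpd hji.symm
        (fun h => hjS ((hmem j).2 h)) b)
      (fun j hj => hρ i j ((hmem j).1 hj)) (hTs.trans hsL.le)).trans ?_
    refine ENNReal.ofReal_le_ofReal ?_
    have h1 : Q⁻¹ ^ (symmDiff T S).card = Real.exp (-Real.log Q * (symmDiff T S).card) := by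
      rw [mul_comm, Real.exp_nat_mul, Real.exp_neg, Real.exp_log hQ0]
    rw [h1]
    refine Real.exp_le_exp.2 (mul_le_mul_of_nonneg_right (neg_le_neg hrate) (by positivity))
  refine (Finset.sum_le_sum hT).trans ?_
  rw [← ENNReal.ofReal_sum_of_nonneg (fun T _ => by positivity)]
  refine ENNReal.ofReal_le_ofReal ?_
  refine le_trans (Finset.sum_le_sum_of_subset_of_nonneg (fun T hT => ?_)
    fun T _ _ => by positivity) (BlockGMS.sum_pow_card_symmDiff_le (q := Q⁻¹) (by positivity)
      hη1.le ?_ S)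
  · exact Finset.mem_erase.2 ⟨(Finset.mem_filter.1 hT).2.2, Finset.mem_univ T⟩
  · have h1 : (p : ℝ) * Q⁻¹ = η / (6 * (s : ℝ) ^ 2) := by rw [hQ]; field_simp
    rw [h1]
    exact div_le_div_of_nonneg_left hη.le (by norm_num) (by linarith)
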